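/- **Corollary (from general to connected event structures).** *Event structures.* An event structure is a triple $E=\langle E,\vdash,\#\rangle$ with a set $E$ of events, a relation ${\vdash}\subseteq \mathcal P_{fin}(E)\times E$ such that $X\vdash e$, $X\subseteq Y$ imply $Y\vdash e$, and a relation ${\#}\subseteq E\times E$. A set $X\subseteq E$ is consistent if $\neg(e\#e')$ for all $e,e'\in X$. A configuration is a consistent $C\subseteq E$ such that each $e\in C$ is the last element of some sequence $e_1,\dots,e_n=e$ in $C$ with $\{e_1,\dots,e_{k-1}\}\vdash e_k$ for all $k\le n$. All event structures are assumed live: $e\#e'$ whenever no configuration contains both $e$ and $e'$, and never $e\#e$. Write $C\vdash_0 e$ if $C$ is a configuration minimal (for inclusion among configurations) with $C\vdash e$. $E$ is connected if whenever $C\vdash_0e$ and $C'\vdash_0e$, the pair $(C,C')$ is in the transitive closure of the relation "$C_1\vdash_0e$, $C_2\vdash_0 e$ and $C_1\cup C_2\cup\{e\}$ is consistent". A morphism $f:E_1\to E_2$ is a partial function such that, wherever $f$ is defined, $f(e)\#f(e')$ implies $e\#e'$; $f(e)=f(e')$ and $e\ne e'$ imply $e\#e'$; and $C\vdash e$ with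 $C$ a configuration implies $f(C)\vdash f(e)$. This gives a category $\mathsf{ES}$, with full subcategory $\mathsf{cES}$ of connected event structures and inclusion $\mathcal I:\mathsf{cES}\to\mathsf{ES}$. *Domains.* A subset of a partial order $D$ is consistent if it has an upper bound, and pairwise consistent if every two of its elements have one. $D$ is a domain if each pairwise consistent subset has a join, each element is the join of the compact elements below it, and only finitely many elements lie below each compact one. An irreducible is a compact $i$ such that $i=\bigsqcup X$ with $X$ a pairwise consistent set of compacts implies $i\in X$; $\mathrm{ir}(d)$ is the set of irreducibles below $d$; an irreducible $i$ has a unique immediate predecessor $p(i)$. For irreducibles, $i\leftrightarrow i'$ means that $\bigsqcup (X\cup\{i\})=\bigsqcup (X\cup\{i'\})$ for every set $X$ of irreducibles such that $X\cup\{i\}$ and $X\cup\{i'\}$ are consistent and downward closed among irreducibles, and $\bigsqcup X\neq\bigsqcup(X\cup\{i\})$ for some such $X$. A weak prime is an irreducible $i$ such that, for consistent $X\subseteq D$ with $i\sqsubseteq\bigsqcup X$, there are $d\in X$ and an irreducible $i'\leftrightarrow i$ with $i'\sqsubseteq d$. $D$ is a weak prime domain if every element is the join of the weak primes below it. Let $d\preceq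 d'$ mean that $d=d'$ or $d$ is an immediate predecessor of $d'$. Morphisms of weak prime domains are the functions that preserve $\preceq$, preserve joins of consistent sets, and preserve $d\sqcap d'$ whenever $d,d'$ are consistent and $d\sqcap d'\preceq d$. The category is $\mathsf{wDom}$. *The constructions.* For an event structure $E$, $\mathcal D(E)$ is the set of configurations of $E$ ordered by inclusion, and $\mathcal D(f)(C)=f(C)$. For a weak prime domain $D$, $\mathcal E(D)$ has as events the classes $[i]$ of irreducibles under the equivalence generated by $\leftrightarrow$, with $e\#e'$ iff there is no compact $d$ with $e,e'\in[\mathrm{ir}(d)]$, and, for finite $X$, $X\vdash e$ iff $[\mathrm{ir}(i)\setminus\{i\}]\subseteq X$ for some $i\in e$. For a morphism $f$, $\mathcal E(f)([i])=[j]$ where $j$ is a minimal element of $\mathrm{ir}(f(i))\setminus\mathrm{ir}(f(p(i)))$, and $\mathcal E(f)([i])$ is undefined if $f(i)=f(p(i))$. *Statement.* $\mathcal D$ is a functor $\mathsf{ES}\to\mathsf{wDom}$; the assignment $\mathcal C=\mathcal E\circ\mathcal D$, i.e. $E\mapsto\mathcal E(\mathcal D(E))$, $f\mapsto\mathcal E(\mathcal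 D(f))$, is well defined and is a functor $\mathsf{ES}\to\mathsf{cES}$; and $\mathcal I$ and $\mathcal C$ form a coreflection: $\mathcal C$ is right adjoint to the inclusion $\mathcal I:\mathsf{cES}\to\mathsf{ES}$. -/

import Mathlib

open CategoryTheory

universe u

namespace ConnES

/-! ### Event structures -/

/-- Event structures `⟨E, ⊢, #⟩` with binary conflict: `Enab X e` is `X ⊢ e`; it relates finite sets
of events to events and is monotone in the finite set. -/
structure EventStructure where
  Event : Type u
  Enab : Set Event → Event → Prop
  Confl : Event → Event → Prop
  enab_finite : ∀ {X e}, Enab X e → X.Finite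
  enab_mono : ∀ {X Y e}, Enab X e → X ⊆ Y → Y.Finite → Enab Y e

namespace EventStructure

/-- `X` is consistent: no two events of `X` are in conflict. -/
def Consistent (E : EventStructure.{u}) (X : Set E.Event) : Prop :=
  ∀ e ∈ X, ∀ e' ∈ X, ¬ E.Confl e e'

/-- The sequence `s 0, …, s n` of elements of `C` ends in `e`, and each of its elements is enabled
by the set of the preceding ones. -/
def Secures (E : EventStructure.{u}) (C : Set E.Event) (e : E.Event) (n : ℕ) (s : ℕ → E.Event) :
    Prop :=
  s n = e ∧ ∀ k ≤ n, s k ∈ C ∧ E.Enab (s '' Set.Iio k) (s k)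

/-- Configurations: consistent secured sets of events (possibly infinite). -/
def IsConfiguration (E : EventStructure.{u}) (C : Set E.Event) : Prop :=
  E.Consistent C ∧ ∀ e ∈ C, ∃ n s, E.Secures C e n s

/-- Live event structures: conflict is saturated and irreflexive. -/
def IsLive (E : EventStructure.{u}) : Prop :=
  (∀ e e', (¬ ∃ C, E.IsConfiguration C ∧ e ∈ C ∧ e' ∈ C) → E.Confl e e') ∧ ∀ e, ¬ E.Confl e e

/-- Minimal enabling `C ⊢₀ e`. -/
def MinEnab (E : EventStructure.{u}) (C : Set E.Event) (e : E.Event) : Prop :=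
  E.IsConfiguration C ∧ E.Enab C e ∧
    ∀ C', E.IsConfiguration C' → C' ⊆ C → E.Enab C' e → C' = C

/-- Two minimal enablings `C`, `C'` of `e` such that `C ∪ C' ∪ {e}` is consistent. -/
def Adjacent (E : EventStructure.{u}) (e : E.Event) (C C' : Set E.Event) : Prop :=
  E.MinEnab C e ∧ E.MinEnab C' e ∧ E.Consistent (C ∪ C' ∪ {e})

/-- Connected event structures: any two minimal enablings of the same event are related by the
transitive closure of `Adjacent`. -/
def IsConnected (E : EventStructure.{u}) : Prop :=
  ∀ e C C', E.MinEnab C e → E.MinEnab C' e → Relation.TransGen (E.Adjacent e) C C'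

/-- Morphisms of event structures: partial functions on events that reflect conflict, are injective
up to conflict, and preserve the enablings whose left-hand side is a configuration. -/
structure IsHom (E₁ E₂ : EventStructure.{u}) (f : E₁.Event →. E₂.Event) : Prop where
  confl : ∀ {e e' y y'}, y ∈ f e → y' ∈ f e' → E₂.Confl y y' → E₁.Confl e e'
  inj : ∀ {e e' y}, y ∈ f e → y ∈ f e' → e ≠ e' → E₁.Confl e e'
  enab : ∀ {C e y}, E₁.IsConfiguration C → E₁.Enab C e → y ∈ f e → E₂.Enab (f.image C) y

theorem Secures.isConfiguration {E : EventStructure.{u}} {C : Set E.Event} {e : E.Event} {n : ℕ}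
    {s : ℕ → E.Event} (hC : E.Consistent C) (h : E.Secures C e n s) {k : ℕ} (hk : k ≤ n) :
    E.IsConfiguration (s '' Set.Iio k) := by
  constructor
  · rintro _ ⟨i, hi, rfl⟩ _ ⟨j, hj, rfl⟩
    simp only [Set.mem_Iio] at hi hj
    exact hC _ (h.2 i (by omega)).1 _ (h.2 j (by omega)).1
  · rintro _ ⟨i, hi, rfl⟩
    simp only [Set.mem_Iio] at hi
    refine ⟨i, s, rfl, fun j hj => ⟨⟨j, ?_, rfl⟩, (h.2 j (by omega)).2⟩⟩
    simp only [Set.mem_Iio]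
    omega

/-- Morphisms map configurations to configurations. -/
theorem IsHom.image_isConfiguration {E₁ E₂ : EventStructure.{u}} {f : E₁.Event →. E₂.Event}
    (hf : IsHom E₁ E₂ f) {C : Set E₁.Event} (hC : E₁.IsConfiguration C) :
    E₂.IsConfiguration (f.image C) := by
  constructor
  · rintro y ⟨e, he, hy⟩ y' ⟨e', he', hy'⟩ hc
    exact hC.1 e he e' he' (hf.confl hy hy' hc)
  · rintro y ⟨e, he, hy⟩
    obtain ⟨n, s, hs⟩ := hC.2 e he
    have key : ∀ k ≤ n, ∃ (m : ℕ) (t : ℕ → E₂.Event), t '' Set.Iio m = f.image (s '' Set.Iio k) ∧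
        ∀ j < m, t j ∈ f.image C ∧ E₂.Enab (t '' Set.Iio j) (t j) := by
      intro k
      induction k with
      | zero =>
        intro _
        refine ⟨0, fun _ => y, ?_, by simp⟩
        ext z
        simp [PFun.image_def]
      | succ k ih =>
        intro hk
        obtain ⟨m, t, ht, hj⟩ := ih (by omega)
        have hsplit : s '' Set.Iio (k + 1) = s '' Set.Iio k ∪ {s k} := by
          rw [← Order.succ_eq_add_one, Order.Iio_succ_eq_insert, Set.image_insert_eq,
            Set.insert_eq, Set.union_comm]
        by_cases hd : (f (s k)).Dom
        · let z := (f (s k)).get hd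
          have hz : z ∈ f (s k) := Part.get_mem hd
          have hlt : ∀ i, i ≤ m →
              (Function.update t m z) '' Set.Iio i = t '' Set.Iio i := by
            intro i hi
            refine Set.image_congr fun a ha => ?_
            simp only [Set.mem_Iio] at ha
            exact Function.update_of_ne (by omega) _ _
          refine ⟨m + 1, Function.update t m z, ?_, ?_⟩
          · rw [hsplit, PFun.image_union, ← ht, ← Order.succ_eq_add_one,
              Order.Iio_succ_eq_insert, Set.image_insert_eq, hlt m le_rfl, Function.update_self,
              Set.insert_eq, Set.union_comm]
            congr 1
            ext w
            simp only [PFun.mem_image, Set.mem_singleton_iff, exists_eq_left]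
            exact ⟨fun h => h ▸ hz, fun h => Part.mem_unique h hz⟩
          · intro j hjm
            rw [hlt j (by omega)]
            rcases Nat.lt_succ_iff_lt_or_eq.1 hjm with h | rfl
            · rw [Function.update_of_ne (by omega)]
              exact hj j h
            · rw [Function.update_self, ht]
              exact ⟨⟨s k, (hs.2 k (by omega)).1, hz⟩,
                hf.enab (hs.isConfiguration hC.1 (by omega)) (hs.2 k (by omega)).2 hz⟩
        · refine ⟨m, t, ?_, hj⟩
          rw [hsplit, PFun.image_union, ht]
          have : f.image {s k} = ∅ := by
            ext w
            simp only [PFun.mem_image, Set.mem_singleton_iff, exists_eq_left,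
              Set.mem_empty_iff_false, iff_false]
            exact fun h => hd (Part.dom_iff_mem.2 ⟨w, h⟩)
          rw [this, Set.union_empty]
    obtain ⟨m, t, ht, hj⟩ := key n le_rfl
    have hy' : y ∈ f (s n) := by rw [hs.1]; exact hy
    have hlt : ∀ i, i ≤ m → (Function.update t m y) '' Set.Iio i = t '' Set.Iio i := by
      intro i hi
      refine Set.image_congr fun a ha => ?_
      simp only [Set.mem_Iio] at ha
      exact Function.update_of_ne (by omega) _ _
    refine ⟨m, Function.update t m y, Function.update_self .., fun k hk => ?_⟩
    rw [hlt k hk]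
    rcases Nat.lt_or_eq_of_le hk with h | rfl
    · rw [Function.update_of_ne (by omega)]
      exact hj k h
    · rw [Function.update_self, ht]
      exact ⟨⟨e, he, hy⟩, hf.enab (hs.isConfiguration hC.1 le_rfl) (hs.2 n le_rfl).2 hy'⟩

theorem isHom_id (E : EventStructure.{u}) : IsHom E E (PFun.id E.Event) where
  confl := by
    intro e e' y y' hy hy' h
    simp only [PFun.id_apply, Part.mem_some_iff] at hy hy'
    exact hy ▸ hy' ▸ h
  inj := by
    intro e e' y hy hy' h
    simp only [PFun.id_apply, Part.mem_some_iff] at hy hy'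
    exact absurd (hy.symm.trans hy') h
  enab := by
    intro C e y _ h hy
    simp only [PFun.id_apply, Part.mem_some_iff] at hy
    have : (PFun.id E.Event).image C = C := by
      ext z
      simp [PFun.mem_image]
    rw [this, hy]
    exact h

theorem image_comp {α β γ : Type u} (g : β →. γ) (f : α →. β) (C : Set α) :
    (g.comp f).image C = g.image (f.image C) := by
  ext z
  constructor
  · rintro ⟨x, hx, hz⟩
    obtain ⟨y, hy, hz⟩ := Part.mem_bind_iff.1 hz
    exact ⟨y, ⟨x, hx, hy⟩, hz⟩
  · rintro ⟨y, ⟨x, hx, hy⟩, hz⟩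
    exact ⟨x, hx, Part.mem_bind_iff.2 ⟨y, hy, hz⟩⟩

theorem IsHom.comp {E₁ E₂ E₃ : EventStructure.{u}} {f : E₁.Event →. E₂.Event}
    {g : E₂.Event →. E₃.Event} (hf : IsHom E₁ E₂ f) (hg : IsHom E₂ E₃ g) :
    IsHom E₁ E₃ (g.comp f) where
  confl := by
    intro e e' z z' hz hz' h
    obtain ⟨y, hy, hyz⟩ := Part.mem_bind_iff.1 hz
    obtain ⟨y', hy', hyz'⟩ := Part.mem_bind_iff.1 hz'
    exact hf.confl hy hy' (hg.confl hyz hyz' h)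
  inj := by
    intro e e' z hz hz' h
    obtain ⟨y, hy, hyz⟩ := Part.mem_bind_iff.1 hz
    obtain ⟨y', hy', hyz'⟩ := Part.mem_bind_iff.1 hz'
    by_cases hyy : y = y'
    · subst hyy
      exact hf.inj hy hy' h
    · exact hf.confl hy hy' (hg.inj hyz hyz' hyy)
  enab := by
    intro C e z hC h hz
    obtain ⟨y, hy, hyz⟩ := Part.mem_bind_iff.1 hz
    rw [image_comp]
    exact hg.enab (hf.image_isConfiguration hC) (hf.enab hC h hy) hyz

end EventStructure

open EventStructure

/-- Objects of the category of event structures: live event structures. -/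
structure ES extends EventStructure.{u} where
  live : toEventStructure.IsLive

/-- Morphisms of the category of event structures. -/
@[ext]
structure ES.Hom (E₁ E₂ : ES.{u}) where
  toPFun : E₁.Event →. E₂.Event
  isHom : IsHom E₁.toEventStructure E₂.toEventStructure toPFun

/-- The category `ES`. -/
instance : Category.{u} ES.{u} where
  Hom := ES.Hom
  id E := ⟨PFun.id E.Event, isHom_id _⟩
  comp f g := ⟨g.toPFun.comp f.toPFun, f.isHom.comp g.isHom⟩
  id_comp f := ES.Hom.ext (PFun.comp_id f.toPFun)
  comp_id f := ES.Hom.ext (PFun.id_comp f.toPFun)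
  assoc f g h := ES.Hom.ext (PFun.comp_assoc h.toPFun g.toPFun f.toPFun).symm

/-- The connected objects of `ES`. -/
def connected : ObjectProperty ES.{u} := fun E => E.toEventStructure.IsConnected

/-- The full subcategory `cES` of connected event structures. -/
abbrev CES : Type (u + 1) := connected.{u}.FullSubcategory

/-! ### Weak prime domains -/

section Domains

variable (D : Type u) [PartialOrder D]

/-- Every two elements of `X` have an upper bound. -/
def PairwiseConsistent {D : Type u} [PartialOrder D] (X : Set D) : Prop :=
  ∀ x ∈ X, ∀ y ∈ X, BddAbove {x, y}

/-- Domains: coherent, algebraic, finitary partial orders. -/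
structure IsDomainPoset : Prop where
  coherent : ∀ X : Set D, PairwiseConsistent X → ∃ s, IsLUB X s
  algebraic : ∀ x : D, IsLUB {c | c ≤ x ∧ IsCompactElement c} x
  finitary : ∀ c : D, IsCompactElement c → (Set.Iic c).Finite

variable {D}

/-- Irreducibles: compact elements `i` such that whenever `i` is the join of a pairwise consistent
set of compact elements, it belongs to that set. -/
def IsIrreducible (i : D) : Prop :=
  IsCompactElement i ∧
    ∀ X : Set D, (∀ x ∈ X, IsCompactElement x) → PairwiseConsistent X → IsLUB X i → i ∈ X

/-- The irreducibles below `d`. -/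
def irr (d : D) : Set D := {i | IsIrreducible i ∧ i ≤ d}

/-- `X ∪ {i}` is a downward closed (among irreducibles) and consistent set of irreducibles. -/
def Extends (X : Set D) (i : D) : Prop :=
  (∀ x ∈ insert i X, irr x ⊆ insert i X) ∧ BddAbove (insert i X)

/-- Interchangeability `i ↔ i'` of irreducibles: adding `i` or `i'` to a set `X` of irreducibles that
both extend has the same join, and for some such `X` it changes the join. -/
def Interchangeable (i i' : D) : Prop :=
  (∀ X : Set D, (∀ x ∈ X, IsIrreducible x) → Extends X i → Extends X i' →
    ∃ s, IsLUB (insert i X) s ∧ IsLUB (insert i' X) s) ∧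
  ∃ X : Set D, (∀ x ∈ X, IsIrreducible x) ∧ Extends X i ∧ Extends X i' ∧
    ∃ s t, IsLUB X s ∧ IsLUB (insert i X) t ∧ s ≠ t

/-- Weak primes. Consistent sets are those that have an upper bound. -/
def IsWeakPrime (i : D) : Prop :=
  IsIrreducible i ∧ ∀ X : Set D, BddAbove X → ∀ s, IsLUB X s → i ≤ s →
    ∃ i', IsIrreducible i' ∧ Interchangeable i i' ∧ ∃ d ∈ X, i' ≤ d

variable (D) in
/-- Weak prime (algebraic) domains. -/
structure IsWeakPrimeDomain : Prop extends IsDomainPoset D where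
  weakPrime : ∀ d : D, IsLUB {i | i ≤ d ∧ IsWeakPrime i} d

end Domains

/-- Morphisms of weak prime domains. Here `d ⩿ d'` is the reflexive immediate precedence relation
(`d = d'` or `d` is an immediate predecessor of `d'`). -/
structure IsDomHom {D₁ D₂ : Type u} [PartialOrder D₁] [PartialOrder D₂] (f : D₁ → D₂) : Prop where
  wcovBy : ∀ {d d'}, d ⩿ d' → f d ⩿ f d'
  join : ∀ {X : Set D₁} {s}, BddAbove X → IsLUB X s → IsLUB (f '' X) (f s)
  meet : ∀ {d d' m}, BddAbove {d, d'} → IsGLB {d, d'} m → m ⩿ d → IsGLB {f d, f d'} (f m)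

section

variable {D₁ D₂ D₃ : Type u} [PartialOrder D₁] [PartialOrder D₂] [PartialOrder D₃]

theorem IsDomHom.monotone {f : D₁ → D₂} (hf : IsDomHom f) : Monotone f := by
  intro d d' h
  have hl : IsLUB {d, d'} d' := by
    constructor
    · rintro x (rfl | rfl)
      exacts [h, le_rfl]
    · intro b hb
      exact hb (by simp)
  exact (hf.join ⟨d', hl.1⟩ hl).1 ⟨d, by simp, rfl⟩

theorem isDomHom_id : IsDomHom (id : D₁ → D₁) where
  wcovBy h := h
  join _ h := by simpa using h
  meet _ h _ := by simpa using h

theorem IsDomHom.comp {f : D₁ → D₂} {g : D₂ → D₃} (hf : IsDomHom f) (hg : IsDomHom g) :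
    IsDomHom (g ∘ f) where
  wcovBy h := hg.wcovBy (hf.wcovBy h)
  join hX h := by
    rw [Set.image_comp]
    exact hg.join (hf.monotone.map_bddAbove hX) (hf.join hX h)
  meet hb h hm := by
    refine hg.meet ?_ (hf.meet hb h hm) (hf.wcovBy hm)
    have := hf.monotone.map_bddAbove hb
    rwa [Set.image_pair] at this

end

/-- Objects of the category `wDom`. -/
structure WDom where
  carrier : Type u
  [order : PartialOrder carrier]
  isWeakPrimeDomain : IsWeakPrimeDomain carrier

attribute [instance] WDom.order

/-- Morphisms of the category `wDom`. -/
@[ext]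
structure WDom.Hom (D₁ D₂ : WDom.{u}) where
  toFun : D₁.carrier → D₂.carrier
  isDomHom : IsDomHom toFun

/-- The category `wDom`. -/
instance : Category.{u} WDom.{u} where
  Hom := WDom.Hom
  id _ := ⟨id, isDomHom_id⟩
  comp f g := ⟨g.toFun ∘ f.toFun, f.isDomHom.comp g.isDomHom⟩

/-! ### From event structures to domains -/

/-- The configurations of an event structure, ordered by inclusion. -/
abbrev Conf (E : EventStructure.{u}) : Type u := {C : Set E.Event // E.IsConfiguration C}

/-- The direct image map on configurations. -/
def confMap {E₁ E₂ : ES.{u}} (f : E₁ ⟶ E₂) (C : Conf E₁.toEventStructure) :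
    Conf E₂.toEventStructure :=
  ⟨f.toPFun.image C.1, f.isHom.image_isConfiguration C.2⟩

/-- `E ↦ Conf E`, `f ↦ confMap f` take event structures and their morphisms to weak prime domains
and their morphisms. -/
structure DomWellDefined : Prop where
  obj : ∀ E : ES.{u}, IsWeakPrimeDomain (Conf E.toEventStructure)
  map : ∀ {E₁ E₂ : ES.{u}} (f : E₁ ⟶ E₂), IsDomHom (confMap f)

/-- The functor `ES ⥤ wDom` of configurations. -/
def domFunctor (h : DomWellDefined.{u}) : ES.{u} ⥤ WDom.{u} where
  obj E := ⟨Conf E.toEventStructure, h.obj E⟩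
  map f := ⟨confMap f, h.map f⟩
  map_id E := by
    refine WDom.Hom.ext (funext fun C => Subtype.ext ?_)
    change (PFun.id E.Event).image C.1 = C.1
    ext z
    simp [PFun.mem_image]
  map_comp f g := WDom.Hom.ext (funext fun C => Subtype.ext (image_comp g.toPFun f.toPFun C.1))

/-! ### From domains to event structures -/

/-- Equivalence classes of irreducibles, for the equivalence relation generated by
interchangeability (interchangeability is reflexive and symmetric in a domain, so that this is its
transitive closure). -/
def IrrClass (D : WDom.{u}) : Type u :=
  Quot fun i j : {i : D.carrier // IsIrreducible i} => Interchangeable i.1 j.1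

/-- The class of an irreducible. -/
def IrrClass.mk {D : WDom.{u}} (i : {i : D.carrier // IsIrreducible i}) : IrrClass D := Quot.mk _ i

/-- The set of the classes of the irreducibles in `X`. -/
def irrClasses {D : WDom.{u}} (X : Set D.carrier) : Set (IrrClass D) :=
  {e | ∃ i, i.1 ∈ X ∧ IrrClass.mk i = e}

/-- The event structure of a weak prime domain: `X ⊢ e` (with `X` finite) if some irreducible `i` in
the class `e` has the classes of all the irreducibles strictly below it in `X`; `e # e'` if no
compact element has irreducibles of both classes below it. -/
def ev (D : WDom.{u}) : EventStructure.{u} where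
  Event := IrrClass D
  Enab X e := X.Finite ∧ ∃ i, IrrClass.mk i = e ∧ irrClasses (irr i.1 \ {i.1}) ⊆ X
  Confl e e' := ¬ ∃ d : D.carrier, IsCompactElement d ∧
    e ∈ irrClasses (irr d) ∧ e' ∈ irrClasses (irr d)
  enab_finite h := h.1
  enab_mono h hXY hY := ⟨hY, h.2.imp fun _ hi => ⟨hi.1, hi.2.trans hXY⟩⟩

/-- For a domain morphism `f`, the relation between the class of an irreducible `i`, with immediate
predecessor `p`, and the class of an irreducible `j` that is minimal among the irreducibles below
`f i` but not below `f p` (there is none when `f i = f p`). -/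
def EvRel {D₁ D₂ : WDom.{u}} (f : D₁ ⟶ D₂) (e₁ : IrrClass D₁) (e₂ : IrrClass D₂) : Prop :=
  ∃ i p j, IrrClass.mk i = e₁ ∧ p ⋖ i.1 ∧
    Minimal (· ∈ irr (f.toFun i.1) \ irr (f.toFun p)) j.1 ∧ IrrClass.mk j = e₂

open Classical in
/-- The partial function with graph `EvRel f` (where `EvRel f` is single-valued). -/
noncomputable def evMap {D₁ D₂ : WDom.{u}} (f : D₁ ⟶ D₂) : (ev D₁).Event →. (ev D₂).Event :=
  fun e₁ => ⟨∃ e₂, EvRel f e₁ e₂, fun h => h.choose⟩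

/-! ### From event structures to connected event structures -/

/-- `E ↦ ev (dom E)`, `f ↦ ev (dom f)` is well defined and functorial, with values in connected event
structures. -/
structure ConnWellDefined (h : DomWellDefined.{u}) : Prop where
  live : ∀ E : ES.{u}, (ev ((domFunctor h).obj E)).IsLive
  connected : ∀ E : ES.{u}, (ev ((domFunctor h).obj E)).IsConnected
  graph : ∀ {E₁ E₂ : ES.{u}} (f : E₁ ⟶ E₂) (e₁ e₂),
    e₂ ∈ evMap ((domFunctor h).map f) e₁ ↔ EvRel ((domFunctor h).map f) e₁ e₂
  isHom : ∀ {E₁ E₂ : ES.{u}} (f : E₁ ⟶ E₂), IsHom _ _ (evMap ((domFunctor h).map f))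
  map_id : ∀ E : ES.{u}, evMap ((domFunctor h).map (𝟙 E)) = PFun.id _
  map_comp : ∀ {E₁ E₂ E₃ : ES.{u}} (f : E₁ ⟶ E₂) (g : E₂ ⟶ E₃),
    evMap ((domFunctor h).map (f ≫ g)) =
      (evMap ((domFunctor h).map g)).comp (evMap ((domFunctor h).map f))

/-- The functor `ES ⥤ cES`, `E ↦ ev (dom E)`, `f ↦ ev (dom f)`. -/
noncomputable def connFunctor (h : DomWellDefined.{u}) (h' : ConnWellDefined h) :
    ES.{u} ⥤ CES.{u} where
  obj E := ⟨⟨ev ((domFunctor h).obj E), h'.live E⟩, h'.connected E⟩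
  map f := ObjectProperty.homMk ⟨evMap ((domFunctor h).map f), h'.isHom f⟩
  map_id E := ObjectProperty.hom_ext _ (ES.Hom.ext (h'.map_id E))
  map_comp f g := ObjectProperty.hom_ext _ (ES.Hom.ext (h'.map_comp f g))

end ConnES

namespace ConnES

/-! ### Securing sequences, configurations and histories. -/

namespace EventStructure

variable {E : EventStructure.{u}}

/-! Everything is expressed through histories, the minimal configurations containing a given event.
A history `I` of `e` is a configuration that enables `e`, with `e` added; hence it is finite,
determines `e`, and has `I \ {e}` as its only immediate predecessor. Bounded joins of configurations
are unions, so the irreducible configurations are exactly the histories (`Conf.isIrreducible_iff`),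
and two of them are interchangeable exactly when they are histories of the same event with a common
upper bound (`Conf.interchangeable_iff`). Weak primality follows, since an event of a union lies in
one of the members and has a history there.

An event of `ev (confDom E)` is therefore an event of `E` together with a class of its histories,
linked by chains of compatible ones. Forgetting the class gives `classLabel`, the counit. The
working rule is that below a single configuration the label determines the class
(`IrrConf.toClass_eq`); it makes the action on morphisms single-valued, functorial and compatible
with enabling. The minimal enablings of a class come from the predecessors of its members
(`minEnab_iff`), so chains of interchangeable histories become chains of adjacent minimal enablings,
which is connectedness.

Conversely, if `E` is connected, all histories of an event form one class
(`toClass_eq_of_label_eq`). Then `classLabel` has an inverse morphism `eventClass`, the unit.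
Naturality of the unit follows from that of the counit, and the triangle identities from
invertibility together with `evConf_map_counitHom`. -/

theorem Secures.mono {C C' : Set E.Event} {e : E.Event} {n : ℕ} {s : ℕ → E.Event}
    (h : E.Secures C e n s) (hC : C ⊆ C') : E.Secures C' e n s :=
  ⟨h.1, fun k hk => ⟨hC (h.2 k hk).1, (h.2 k hk).2⟩⟩

theorem Consistent.mono {X Y : Set E.Event} (h : E.Consistent Y) (hXY : X ⊆ Y) : E.Consistent X :=
  fun e he e' he' => h e (hXY he) e' (hXY he')

theorem isConfiguration_biUnion {ι : Type*} {S : Set ι} {C : ι → Set E.Event}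
    (hC : ∀ i ∈ S, E.IsConfiguration (C i)) (h : E.Consistent (⋃ i ∈ S, C i)) :
    E.IsConfiguration (⋃ i ∈ S, C i) := by
  refine ⟨h, fun e he => ?_⟩
  obtain ⟨i, hi, he⟩ := Set.mem_iUnion₂.1 he
  obtain ⟨n, s, hs⟩ := (hC i hi).2 e he
  exact ⟨n, s, hs.mono (Set.subset_biUnion_of_mem hi)⟩

theorem IsConfiguration.union {C C' : Set E.Event} (hC : E.IsConfiguration C)
    (hC' : E.IsConfiguration C') (h : E.Consistent (C ∪ C')) : E.IsConfiguration (C ∪ C') := by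
  refine ⟨h, ?_⟩
  rintro e (he | he)
  · obtain ⟨n, s, hs⟩ := hC.2 e he
    exact ⟨n, s, hs.mono Set.subset_union_left⟩
  · obtain ⟨n, s, hs⟩ := hC'.2 e he
    exact ⟨n, s, hs.mono Set.subset_union_right⟩

theorem isConfiguration_empty : E.IsConfiguration ∅ :=
  ⟨fun _ h => h.elim, fun _ h => h.elim⟩

/-- Securing sequences of finitely many events can be concatenated. -/
theorem exists_securing_sequence {C X : Set E.Event} (e : E.Event) (hX : X.Finite)
    (h : ∀ x ∈ X, ∃ n s, E.Secures C x n s) :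
    ∃ (m : ℕ) (t : ℕ → E.Event), (∀ j < m, t j ∈ C ∧ E.Enab (t '' Set.Iio j) (t j)) ∧
      X ⊆ t '' Set.Iio m := by
  induction X, hX using Set.Finite.induction_on with
  -- Here `e` is only a default value for the empty sequence.
  | empty => exact ⟨0, fun _ => e, by simp, by simp⟩
  | @insert a X _ _ ih =>
    obtain ⟨m, t, ht, hX⟩ := ih fun x hx => h x (Set.mem_insert_of_mem _ hx)
    obtain ⟨n, s, hs⟩ := h a (Set.mem_insert _ _)
    -- Run `t` for `m` terms and then `s`; monotonicity of enabling allows the extra predecessors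
    -- coming from `t`.
    let r : ℕ → E.Event := fun j => if j < m then t j else s (j - m)
    have hr₁ : ∀ j, j < m → r j = t j := fun j hj => if_pos hj
    have hr₂ : ∀ j, r (m + j) = s j := fun j => by simp [r]
    refine ⟨m + n + 1, r, fun j hj => ?_, ?_⟩
    · by_cases hjm : j < m
      · rw [hr₁ j hjm]
        refine ⟨(ht j hjm).1, E.enab_mono (ht j hjm).2 ?_ ((Set.finite_Iio j).image r)⟩
        rintro _ ⟨i, hi, rfl⟩
        exact ⟨i, hi, hr₁ i (lt_trans hi hjm)⟩
      · obtain ⟨k, rfl⟩ := Nat.exists_eq_add_of_le (not_lt.1 hjm)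
        rw [hr₂ k]
        refine ⟨(hs.2 k (by omega)).1,
          E.enab_mono (hs.2 k (by omega)).2 ?_ ((Set.finite_Iio (m + k)).image r)⟩
        rintro _ ⟨i, hi, rfl⟩
        exact ⟨m + i, Nat.add_lt_add_left hi m, hr₂ i⟩
    · rintro x (rfl | hx)
      · exact ⟨m + n, by simp, by rw [hr₂, hs.1]⟩
      · obtain ⟨i, hi, rfl⟩ := hX hx
        have hi' : i < m := hi
        exact ⟨i, by simp only [Set.mem_Iio]; omega, hr₁ i hi⟩

/-- An event enabled by finitely many secured events is secured. -/
theorem exists_secures_of_enab {C X : Set E.Event} {e : E.Event} (he : e ∈ C) (hX : E.Enab X e)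
    (h : ∀ x ∈ X, ∃ n s, E.Secures C x n s) : ∃ n s, E.Secures C e n s := by
  obtain ⟨m, t, ht, hXt⟩ := exists_securing_sequence e (E.enab_finite hX) h
  have hlt : ∀ i, i ≤ m → Function.update t m e '' Set.Iio i = t '' Set.Iio i := by
    intro i hi
    refine Set.image_congr fun a ha => Function.update_of_ne ?_ _ _
    simp only [Set.mem_Iio] at ha
    omega
  refine ⟨m, Function.update t m e, Function.update_self .., fun k hk => ?_⟩
  rw [hlt k hk]
  rcases Nat.lt_or_eq_of_le hk with h | rfl
  · rw [Function.update_of_ne (by omega)]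
    exact ht k h
  · rw [Function.update_self]
    exact ⟨he, E.enab_mono hX hXt ((Set.finite_Iio k).image t)⟩

theorem IsConfiguration.insert_of_enab {C X : Set E.Event} {e : E.Event} (hC : E.IsConfiguration C)
    (hXC : X ⊆ C) (hX : E.Enab X e) (h : E.Consistent (insert e C)) :
    E.IsConfiguration (insert e C) := by
  have key : ∀ x ∈ C, ∃ n s, E.Secures (insert e C) x n s := fun x hx => by
    obtain ⟨n, s, hs⟩ := hC.2 x hx
    exact ⟨n, s, hs.mono (Set.subset_insert _ _)⟩
  refine ⟨h, ?_⟩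
  rintro x (rfl | hx)
  · exact exists_secures_of_enab (Set.mem_insert _ _) hX fun y hy => key y (hXC hy)
  · exact key x hx

/-- A set that does not contain the configuration `C'` enables an event of `C'` outside of it. -/
theorem IsConfiguration.exists_enab_notMem {C C' : Set E.Event} (hC' : E.IsConfiguration C')
    (h : ¬ C' ⊆ C) :
    ∃ e ∈ C', e ∉ C ∧ ∃ X ⊆ C, E.Enab X e := by
  classical
  obtain ⟨e, he, heC⟩ := Set.not_subset.1 h
  obtain ⟨n, s, hs⟩ := hC'.2 e he
  -- The first term of the securing sequence outside `C` is enabled by its predecessors, which all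
  -- lie in `C`.
  have hex : ∃ k, s k ∉ C := ⟨n, by rwa [hs.1]⟩
  have hle : Nat.find hex ≤ n := Nat.find_min' hex (by rwa [hs.1])
  refine ⟨s (Nat.find hex), (hs.2 _ hle).1, Nat.find_spec hex, _, ?_, (hs.2 _ hle).2⟩
  rintro _ ⟨i, hi, rfl⟩
  exact not_not.1 (Nat.find_min hex hi)

/-- Each event of a configuration is enabled by a finite subconfiguration that does not contain
it. -/
theorem IsConfiguration.exists_enab {C : Set E.Event} (hC : E.IsConfiguration C) {e : E.Event}
    (he : e ∈ C) : ∃ P ⊆ C, E.IsConfiguration P ∧ E.Enab P e ∧ e ∉ P := by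
  classical
  obtain ⟨n, s, hs⟩ := hC.2 e he
  -- Cutting the sequence at the first occurrence of `e` keeps `e` out of the enabling prefix.
  have hex : ∃ k, s k = e := ⟨n, hs.1⟩
  have hle : Nat.find hex ≤ n := Nat.find_min' hex hs.1
  refine ⟨s '' Set.Iio (Nat.find hex), ?_, hs.isConfiguration hC.1 hle, ?_, ?_⟩
  · rintro _ ⟨i, hi, rfl⟩
    exact (hs.2 i (le_trans (le_of_lt hi) hle)).1
  · have := (hs.2 _ hle).2
    rwa [Nat.find_spec hex] at this
  · rintro ⟨i, hi, h⟩
    exact Nat.find_min hex hi h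

/-- Histories of `e`: minimal configurations containing `e`. -/
def IsHistory (E : EventStructure.{u}) (I : Set E.Event) (e : E.Event) : Prop :=
  Minimal (fun C => E.IsConfiguration C ∧ e ∈ C) I

theorem IsHistory.mem {I : Set E.Event} {e : E.Event} (h : E.IsHistory I e) : e ∈ I := h.prop.2

theorem IsHistory.isConfiguration {I : Set E.Event} {e : E.Event} (h : E.IsHistory I e) :
    E.IsConfiguration I := h.prop.1

theorem IsHistory.eq_of_subset {I C : Set E.Event} {e : E.Event} (h : E.IsHistory I e)
    (hC : E.IsConfiguration C) (he : e ∈ C) (hCI : C ⊆ I) : C = I :=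
  hCI.antisymm (h.2 ⟨hC, he⟩ hCI)

/-- An enabling subconfiguration `P` of `I` that omits `e` becomes, with `e` added, a configuration
inside `I` containing `e`, so minimality of `I` forces equality. The structure of histories is read
off from this decomposition. -/
theorem IsHistory.exists_eq_insert {I : Set E.Event} {e : E.Event} (h : E.IsHistory I e) :
    ∃ P, E.IsConfiguration P ∧ E.Enab P e ∧ e ∉ P ∧ I = insert e P := by
  obtain ⟨P, hPI, hP, hPe, heP⟩ := h.isConfiguration.exists_enab h.mem
  have hsub : insert e P ⊆ I := Set.insert_subset h.mem hPI
  exact ⟨P, hP, hPe, heP, (h.eq_of_subset (hP.insert_of_enab subset_rfl hPe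
    (h.isConfiguration.1.mono hsub)) (Set.mem_insert _ _) hsub).symm⟩

theorem IsHistory.finite {I : Set E.Event} {e : E.Event} (h : E.IsHistory I e) : I.Finite := by
  obtain ⟨P, -, hPe, -, rfl⟩ := h.exists_eq_insert
  exact (E.enab_finite hPe).insert e

theorem IsHistory.isConfiguration_diff {I : Set E.Event} {e : E.Event} (h : E.IsHistory I e) :
    E.IsConfiguration (I \ {e}) := by
  obtain ⟨P, hP, -, he, rfl⟩ := h.exists_eq_insert
  rwa [Set.insert_sdiff_self_of_notMem he]

theorem IsHistory.enab_diff {I : Set E.Event} {e : E.Event} (h : E.IsHistory I e) :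
    E.Enab (I \ {e}) e := by
  obtain ⟨P, -, hP, he, rfl⟩ := h.exists_eq_insert
  rwa [Set.insert_sdiff_self_of_notMem he]

/-- Otherwise `I \ {e}` would be a strictly smaller configuration containing `e'`. -/
theorem IsHistory.event_unique {I : Set E.Event} {e e' : E.Event} (h : E.IsHistory I e)
    (h' : E.IsHistory I e') : e = e' := by
  by_contra hne
  have := h'.eq_of_subset h.isConfiguration_diff ⟨h'.mem, Ne.symm hne⟩ Set.sdiff_subset
  exact (this ▸ h.mem).2 rfl

/-- Enabling sets are finite, so a minimal configuration can be found among the finitely many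
subsets of `insert e P`, even when `C` is infinite. -/
theorem IsConfiguration.exists_isHistory {C : Set E.Event} (hC : E.IsConfiguration C) {e : E.Event}
    (he : e ∈ C) : ∃ I ⊆ C, E.IsHistory I e := by
  obtain ⟨P, hPC, hP, hPe, -⟩ := hC.exists_enab he
  have hsub : insert e P ⊆ C := Set.insert_subset he hPC
  have hfin : {C' | C' ⊆ insert e P ∧ E.IsConfiguration C' ∧ e ∈ C'}.Finite :=
    ((E.enab_finite hPe).insert e).finite_subsets.subset fun _ h => h.1
  obtain ⟨I, hI, hmin⟩ := hfin.exists_le_minimal (a := insert e P)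
    ⟨subset_rfl, hP.insert_of_enab subset_rfl hPe (hC.1.mono hsub), Set.mem_insert _ _⟩
  refine ⟨I, hI.trans hsub, ⟨hmin.prop.2, fun C' hC' hle => hmin.2 ⟨hle.trans hI, hC'⟩ hle⟩⟩

theorem MinEnab.notMem {C : Set E.Event} {e : E.Event} (h : E.MinEnab C e) : e ∉ C := by
  intro he
  obtain ⟨P, hPC, hP, hPe, heP⟩ := h.1.exists_enab he
  exact heP (h.2.2 P hP hPC hPe ▸ he)

/-- A minimal enabling of `e` that is consistent with `e` yields a history of `e`. -/
theorem MinEnab.isHistory {C : Set E.Event} {e : E.Event} (h : E.MinEnab C e)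
    (hC : E.Consistent (insert e C)) : E.IsHistory (insert e C) e := by
  refine ⟨⟨h.1.insert_of_enab subset_rfl h.2.1 hC, Set.mem_insert _ _⟩, ?_⟩
  rintro C' ⟨hC', he⟩ hle
  obtain ⟨P, hPC, hP, hPe, heP⟩ := hC'.exists_enab he
  have hPC' : P ⊆ C := fun x hx => ((hle (hPC hx)).resolve_left fun hxe => heP (hxe ▸ hx))
  rw [← h.2.2 P hP hPC' hPe]
  exact Set.insert_subset he hPC

theorem IsHistory.minEnab {I : Set E.Event} {e : E.Event} (h : E.IsHistory I e) :
    E.MinEnab (I \ {e}) e := by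
  refine ⟨h.isConfiguration_diff, h.enab_diff, fun C hC hsub hCe => hsub.antisymm ?_⟩
  have hsub' : insert e C ⊆ I := Set.insert_subset h.mem (hsub.trans Set.sdiff_subset)
  rw [← h.eq_of_subset (hC.insert_of_enab subset_rfl hCe (h.isConfiguration.1.mono hsub'))
    (Set.mem_insert _ _) hsub']
  exact fun x hx => hx.1.resolve_left hx.2

theorem IsConfiguration.exists_minEnab {C : Set E.Event} (hC : E.IsConfiguration C) {e : E.Event}
    (he : E.Enab C e) : ∃ C' ⊆ C, E.MinEnab C' e := by
  have hfin : {C' | C' ⊆ C ∧ E.IsConfiguration C' ∧ E.Enab C' e}.Finite :=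
    (E.enab_finite he).finite_subsets.subset fun _ h => h.1
  obtain ⟨I, hI, hmin⟩ := hfin.exists_le_minimal (a := C) ⟨subset_rfl, hC, he⟩
  exact ⟨I, hI, hmin.prop.2.1, hmin.prop.2.2, fun C' hC' hle hCe =>
    hle.antisymm (hmin.2 ⟨hle.trans hI, hC', hCe⟩ hle)⟩

end EventStructure

open EventStructure

/-! ### The weak prime domain of configurations. -/

namespace Conf

variable {E : EventStructure.{u}}

/-- Conflict is binary: two events of the union already lie in two members, which have a common
upper bound. -/
theorem bddAbove_of_pairwiseConsistent {X : Set (Conf E)} (h : PairwiseConsistent X) :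
    BddAbove X := by
  refine ⟨⟨⋃ c ∈ X, c.1, isConfiguration_biUnion (fun c _ => c.2) ?_⟩,
    fun c hc => Set.subset_biUnion_of_mem (u := fun c : Conf E => c.1) hc⟩
  intro e he e' he'
  obtain ⟨c, hc, he⟩ := Set.mem_iUnion₂.1 he
  obtain ⟨c', hc', he'⟩ := Set.mem_iUnion₂.1 he'
  obtain ⟨b, hb⟩ := h c hc c' hc'
  exact b.2.1 e (hb (Set.mem_insert _ _) he) e' (hb (Set.mem_insert_of_mem _ rfl) he')

/-- The join of a bounded set of configurations is its union. -/
theorem exists_isLUB {X : Set (Conf E)} (h : BddAbove X) :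
    ∃ s : Conf E, IsLUB X s ∧ s.1 = ⋃ c ∈ X, c.1 := by
  obtain ⟨b, hb⟩ := h
  have hsub : (⋃ c ∈ X, c.1) ⊆ b.1 := Set.iUnion₂_subset fun c hc => hb hc
  refine ⟨⟨⋃ c ∈ X, c.1, isConfiguration_biUnion (fun c _ => c.2) (b.2.1.mono hsub)⟩,
    ⟨fun c hc => Set.subset_biUnion_of_mem (u := fun c : Conf E => c.1) hc,
      fun d hd => Set.iUnion₂_subset fun c hc => hd hc⟩, rfl⟩

theorem isLUB_iff {X : Set (Conf E)} (h : BddAbove X) {s : Conf E} :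
    IsLUB X s ↔ s.1 = ⋃ c ∈ X, c.1 := by
  obtain ⟨t, ht, hts⟩ := exists_isLUB h
  rw [← hts]
  exact ⟨fun hs => by rw [hs.unique ht], fun hs => by rwa [Subtype.ext hs]⟩

theorem bddAbove_pair {c d : Conf E} (h : E.Consistent (c.1 ∪ d.1)) : BddAbove {c, d} :=
  ⟨⟨c.1 ∪ d.1, c.2.union d.2 h⟩, by
    rintro x (rfl | rfl)
    exacts [Set.subset_union_left, Set.subset_union_right]⟩

/-- The histories contained in `c` cover it. -/
theorem exists_isHistory_le (c : Conf E) {e : E.Event} (he : e ∈ c.1) :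
    ∃ i : Conf E, i ≤ c ∧ E.IsHistory i.1 e := by
  obtain ⟨I, hI, h⟩ := c.2.exists_isHistory he
  exact ⟨⟨I, h.isConfiguration⟩, hI, h⟩

theorem isCompactElement_of_finite {c : Conf E} (hc : c.1.Finite) : IsCompactElement c := by
  intro S s hne hdir hs hcs
  have hbdd : BddAbove S := ⟨s, hs.1⟩
  rw [isLUB_iff hbdd] at hs
  have hcs' : c.1 ⊆ s.1 := hcs
  rw [hs] at hcs'
  have key : ∀ X : Set E.Event, X.Finite → X ⊆ (⋃ d ∈ S, d.1) → ∃ d ∈ S, X ⊆ d.1 := by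
    intro X hX
    induction X, hX using Set.Finite.induction_on with
    | empty => exact fun _ => hne.imp fun d hd => ⟨hd, Set.empty_subset _⟩
    | insert _ _ ih =>
      intro hsub
      obtain ⟨ha, hX⟩ := Set.insert_subset_iff.1 hsub
      obtain ⟨d, hd, hXd⟩ := ih hX
      obtain ⟨d', hd', had⟩ := Set.mem_iUnion₂.1 ha
      obtain ⟨b, hb, hdb, hdb'⟩ := hdir d hd d' hd'
      exact ⟨b, hb, Set.insert_subset (hdb' had) (hXd.trans hdb)⟩
  exact key c.1 hc hcs'

/-- A configuration is the directed join of its finite subconfigurations, because each of its events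
has a finite history in it. -/
theorem finite_of_isCompactElement {c : Conf E} (hc : IsCompactElement c) : c.1.Finite := by
  let S : Set (Conf E) := {d | d ≤ c ∧ d.1.Finite}
  have hbdd : BddAbove S := ⟨c, fun d hd => hd.1⟩
  obtain ⟨d, hd, hcd⟩ := hc S c
    ⟨⟨∅, isConfiguration_empty⟩, Set.empty_subset _, Set.finite_empty⟩ (by
      rintro d ⟨hd, hdf⟩ d' ⟨hd', hdf'⟩
      have hsub : d.1 ∪ d'.1 ⊆ c.1 := Set.union_subset hd hd'
      exact ⟨⟨d.1 ∪ d'.1, d.2.union d'.2 (c.2.1.mono hsub)⟩, ⟨hsub, hdf.union hdf'⟩,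
        Set.subset_union_left, Set.subset_union_right⟩) (by
      rw [isLUB_iff hbdd]
      refine Set.Subset.antisymm (fun e he => ?_) (Set.iUnion₂_subset fun d hd => hd.1)
      obtain ⟨i, hi, h⟩ := c.exists_isHistory_le he
      exact Set.mem_iUnion₂.2 ⟨i, ⟨hi, h.finite⟩, h.mem⟩) le_rfl
  exact hd.2.subset hcd

/-- A configuration is the union of the histories it contains, so an irreducible one must be among
them. Conversely, if a history of `e` is a union, some member contains `e` and equals the history by
minimality. -/
theorem isIrreducible_iff {i : Conf E} : IsIrreducible i ↔ ∃ e, E.IsHistory i.1 e := by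
  constructor
  · rintro ⟨-, h⟩
    let X : Set (Conf E) := {j | j ≤ i ∧ ∃ e, E.IsHistory j.1 e}
    have hbdd : ∀ x ∈ X, x ≤ i := fun x hx => hx.1
    refine (h X ?_ ?_ ?_).2
    · rintro x ⟨-, e, hx⟩
      exact isCompactElement_of_finite hx.finite
    · refine fun x hx y hy => ⟨i, ?_⟩
      rintro z (rfl | rfl)
      exacts [hx.1, hy.1]
    · rw [isLUB_iff ⟨i, hbdd⟩]
      refine Set.Subset.antisymm (fun e he => ?_) (Set.iUnion₂_subset hbdd)
      obtain ⟨j, hj, h⟩ := i.exists_isHistory_le he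
      exact Set.mem_iUnion₂.2 ⟨j, ⟨hj, e, h⟩, h.mem⟩
  · rintro ⟨e, he⟩
    refine ⟨isCompactElement_of_finite he.finite, fun X _ _ hX => ?_⟩
    have hmem := he.mem
    rw [(isLUB_iff ⟨i, hX.1⟩).1 hX] at hmem
    obtain ⟨x, hx, hex⟩ := Set.mem_iUnion₂.1 hmem
    rwa [← Subtype.ext (he.eq_of_subset x.2 hex (hX.1 hx))]

theorem mem_of_extends {X : Set (Conf E)} {i : Conf E} (h : Extends X i) {j : Conf E}
    (hj : IsIrreducible j) (hji : j ≤ i) (hne : j ≠ i) : j ∈ X :=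
  (h.1 i (Set.mem_insert _ _) ⟨hj, hji⟩).resolve_left hne

/-- Adding a history of `e` to a set of irreducibles adds the event `e` to its join. -/
theorem biUnion_insert_of_extends {X : Set (Conf E)} {i : Conf E} {e : E.Event}
    (hi : E.IsHistory i.1 e) (h : Extends X i) :
    ⋃ c ∈ insert i X, c.1 = insert e (⋃ c ∈ X, c.1) := by
  rw [Set.biUnion_insert]
  refine Set.Subset.antisymm (Set.union_subset (fun x hx => ?_) (Set.subset_insert _ _))
    (Set.insert_subset (Or.inl hi.mem) Set.subset_union_right)
  by_cases hxe : x = e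
  · exact Or.inl hxe
  · obtain ⟨j, hj, hjx⟩ :=
      exists_isHistory_le (⟨_, hi.isConfiguration_diff⟩ : Conf E) (e := x) ⟨hx, hxe⟩
    have hji : j.1 ⊆ i.1 \ {e} := hj
    refine Or.inr (Set.mem_iUnion₂.2 ⟨j, mem_of_extends h (isIrreducible_iff.2 ⟨x, hjx⟩)
      (hji.trans Set.sdiff_subset) ?_, hjx.mem⟩)
    rintro rfl
    exact (hji hi.mem).2 rfl

theorem _root_.ConnES.Extends.bddAbove {X : Set (Conf E)} {i : Conf E} (h : Extends X i) :
    BddAbove X :=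
  h.2.mono (Set.subset_insert _ _)

/-- Two histories are interchangeable iff they are consistent histories of the same event. -/
theorem interchangeable_iff {i i' : Conf E} {e e' : E.Event} (hi : E.IsHistory i.1 e)
    (hi' : E.IsHistory i'.1 e') : Interchangeable i i' ↔ e = e' ∧ BddAbove {i, i'} := by
  constructor
  · rintro ⟨h₁, X, hX, hXi, hXi', s, t, hs, ht, hst⟩
    obtain ⟨r, hr, hr'⟩ := h₁ X hX hXi hXi'
    rw [isLUB_iff hXi.bddAbove] at hs
    rw [isLUB_iff hXi.2, biUnion_insert_of_extends hi hXi, ← hs] at ht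
    have hsr := (isLUB_iff hXi.2).1 hr
    have hsr' := (isLUB_iff hXi'.2).1 hr'
    rw [biUnion_insert_of_extends hi hXi, ← hs] at hsr
    rw [biUnion_insert_of_extends hi' hXi', ← hs] at hsr'
    have hes : e ∉ s.1 := fun he =>
      hst (Subtype.ext (by rw [ht, Set.insert_eq_of_mem he]))
    have he : e ∈ insert e' s.1 := hsr' ▸ hsr ▸ Set.mem_insert _ _
    refine ⟨he.resolve_right hes, r, ?_⟩
    rintro x (rfl | rfl)
    exacts [hr.1 (Set.mem_insert _ _), hr'.1 (Set.mem_insert _ _)]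
  · rintro ⟨rfl, b, hb⟩
    have hib : i ≤ b := hb (Set.mem_insert _ _)
    have hib' : i' ≤ b := hb (Set.mem_insert_of_mem _ rfl)
    -- The witness consists of the irreducibles below `i` or `i'` that omit `e`: it contains
    -- everything strictly below either history, and its join still lacks `e`.
    refine ⟨fun X _ hXi hXi' => ?_, {j | IsIrreducible j ∧ e ∉ j.1 ∧ (j ≤ i ∨ j ≤ i')},
      fun x hx => hx.1, ?_⟩
    · obtain ⟨s, hs⟩ := exists_isLUB hXi.2
      refine ⟨s, hs.1, (isLUB_iff hXi'.2).2 ?_⟩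
      rw [biUnion_insert_of_extends hi' hXi', ← biUnion_insert_of_extends hi hXi, hs.2]
    · have key : ∀ k, E.IsHistory k.1 e → (k = i ∨ k = i') →
          Extends {j | IsIrreducible j ∧ e ∉ j.1 ∧ (j ≤ i ∨ j ≤ i')} k := by
        intro k hk hki
        refine ⟨?_, b, ?_⟩
        · rintro x (rfl | hx) j ⟨hj, hjx⟩
          · by_cases hej : e ∈ j.1
            · exact Or.inl (Subtype.ext (hk.eq_of_subset j.2 hej hjx))
            · refine Or.inr ⟨hj, hej, ?_⟩
              rcases hki with rfl | rfl
              exacts [Or.inl hjx, Or.inr hjx]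
          · exact Or.inr ⟨hj, fun hej => hx.2.1 (hjx hej),
              hx.2.2.imp (le_trans hjx) (le_trans hjx)⟩
        · rintro x (rfl | ⟨-, -, hx | hx⟩)
          · rcases hki with rfl | rfl
            exacts [hib, hib']
          · exact hx.trans hib
          · exact hx.trans hib'
      have hXi := key i hi (Or.inl rfl)
      obtain ⟨s, hs, hs'⟩ := exists_isLUB hXi.bddAbove
      obtain ⟨t, ht, ht'⟩ := exists_isLUB hXi.2
      refine ⟨hXi, key i' hi' (Or.inr rfl), s, t, hs, ht, ?_⟩
      rintro rfl
      have : e ∈ s.1 := by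
        rw [ht']
        exact Set.mem_iUnion₂.2 ⟨i, Set.mem_insert _ _, hi.mem⟩
      rw [hs'] at this
      obtain ⟨j, hj, hej⟩ := Set.mem_iUnion₂.1 this
      exact hj.2.1 hej

theorem isWeakPrime_of_isHistory {i : Conf E} {e : E.Event} (hi : E.IsHistory i.1 e) :
    IsWeakPrime i := by
  refine ⟨isIrreducible_iff.2 ⟨e, hi⟩, fun X hX s hs his => ?_⟩
  have hes : e ∈ s.1 := his hi.mem
  rw [(isLUB_iff hX).1 hs] at hes
  obtain ⟨d, hd, hed⟩ := Set.mem_iUnion₂.1 hes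
  obtain ⟨i', hi'd, hi'⟩ := d.exists_isHistory_le hed
  refine ⟨i', isIrreducible_iff.2 ⟨e, hi'⟩, (interchangeable_iff hi hi').2 ⟨rfl, s, ?_⟩, d, hd, hi'd⟩
  rintro x (rfl | rfl)
  exacts [his, hi'd.trans (hs.1 hd)]

theorem isLUB_of_histories {c : Conf E} {X : Set (Conf E)} (hX : ∀ x ∈ X, x ≤ c)
    (h : ∀ i ≤ c, ∀ e, E.IsHistory i.1 e → i ∈ X) : IsLUB X c := by
  rw [isLUB_iff ⟨c, hX⟩]
  refine Set.Subset.antisymm (fun e he => ?_) (Set.iUnion₂_subset hX)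
  obtain ⟨i, hi, hie⟩ := c.exists_isHistory_le he
  exact Set.mem_iUnion₂.2 ⟨i, h i hi e hie, hie.mem⟩

theorem isWeakPrimeDomain (E : EventStructure.{u}) : IsWeakPrimeDomain (Conf E) where
  coherent X hX := (exists_isLUB (bddAbove_of_pairwiseConsistent hX)).imp fun _ h => h.1
  algebraic c := isLUB_of_histories (fun _ hx => hx.1) fun _ hi _ h =>
    ⟨hi, isCompactElement_of_finite h.finite⟩
  finitary c hc := by
    refine Set.Finite.of_finite_image (f := Subtype.val) ?_ Subtype.val_injective.injOn
    refine (finite_of_isCompactElement hc).finite_subsets.subset ?_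
    rintro _ ⟨d, hd, rfl⟩
    exact hd
  weakPrime c := isLUB_of_histories (fun _ hx => hx.1) fun _ hi _ h =>
    ⟨hi, isWeakPrime_of_isHistory h⟩

/-- Some event of `d` outside `c` is enabled from within `c`; adding it gives a configuration
between `c` and `d`, hence `d` itself. -/
theorem eq_insert_of_covBy {c d : Conf E} (h : c ⋖ d) : ∃ e, e ∉ c.1 ∧ d.1 = insert e c.1 := by
  obtain ⟨e, hed, hec, X, hX, hXe⟩ := d.2.exists_enab_notMem (not_le_of_gt h.lt)
  have hsub : insert e c.1 ⊆ d.1 := Set.insert_subset hed h.le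
  let b : Conf E := ⟨insert e c.1, c.2.insert_of_enab hX hXe (d.2.1.mono hsub)⟩
  have hcb : c < b := lt_of_le_of_ne (Set.subset_insert _ _) fun hcb =>
    hec (by rw [hcb]; exact Set.mem_insert _ _)
  exact ⟨e, hec, by rw [← eq_of_le_of_not_lt (show b ≤ d from hsub) (h.2 hcb)]⟩

theorem wcovBy_of_subset_insert {c d : Conf E} {e : E.Event} (h : c ≤ d)
    (hd : d.1 ⊆ insert e c.1) : c ⩿ d := by
  refine ⟨h, fun b hcb hbd => ?_⟩
  obtain ⟨x, hxb, hxc⟩ := Set.not_subset.1 (not_le_of_gt hcb)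
  have hxe : x = e := (hd (hbd.le hxb)).resolve_right hxc
  exact not_le_of_gt hbd (show d.1 ⊆ b.1 from
    hd.trans (Set.insert_subset (hxe ▸ hxb) hcb.le))

theorem isGLB_pair_of_forall {c d m : Conf E} (hc : m ≤ c) (hd : m ≤ d)
    (h : c.1 ∩ d.1 ⊆ m.1) : IsGLB {c, d} m := by
  constructor
  · rintro x (rfl | rfl)
    exacts [hc, hd]
  · intro b hb
    exact Set.Subset.trans (Set.subset_inter (hb (Set.mem_insert _ _))
      (hb (Set.mem_insert_of_mem _ rfl))) h

end Conf

/-! ### Direct images as morphisms of domains. -/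

theorem finite_image {α β : Type*} (f : α →. β) {C : Set α} (h : C.Finite) :
    (f.image C).Finite := by
  refine (h.biUnion (t := fun x => {y | y ∈ f x}) fun x _ =>
    Set.Subsingleton.finite fun y hy z hz => Part.mem_unique hy hz).subset ?_
  rintro y ⟨x, hx, hy⟩
  exact Set.mem_biUnion hx hy

theorem confMap_mono {E₁ E₂ : ES.{u}} (f : E₁ ⟶ E₂) : Monotone (confMap f) :=
  fun _ _ h => f.toPFun.image_mono h

theorem isDomHom_confMap {E₁ E₂ : ES.{u}} (f : E₁ ⟶ E₂) : IsDomHom (confMap f) where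
  wcovBy {c d} h := by
    rcases h.covBy_or_eq with h | rfl
    · obtain ⟨e, -, hd⟩ := Conf.eq_insert_of_covBy h
      by_cases hf : (f.toPFun e).Dom
      · refine Conf.wcovBy_of_subset_insert (e := (f.toPFun e).get hf) (confMap_mono f h.le) ?_
        rintro y ⟨x, hx, hy⟩
        rw [hd] at hx
        rcases hx with rfl | hx
        · exact Or.inl (Part.mem_unique hy (Part.get_mem hf))
        · exact Or.inr ⟨x, hx, hy⟩
      · refine le_antisymm (confMap_mono f h.le) ?_ ▸ WCovBy.rfl
        rintro y ⟨x, hx, hy⟩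
        rw [hd] at hx
        rcases hx with rfl | hx
        · exact absurd (Part.dom_iff_mem.2 ⟨y, hy⟩) hf
        · exact ⟨x, hx, hy⟩
    · exact WCovBy.rfl
  join {X s} hX hs := by
    rw [Conf.isLUB_iff hX] at hs
    rw [Conf.isLUB_iff ((confMap_mono f).map_bddAbove hX)]
    ext y
    simp only [confMap, hs, PFun.mem_image, Set.mem_iUnion, Set.mem_image, exists_prop]
    constructor
    · rintro ⟨x, ⟨c, hc, hx⟩, hy⟩
      exact ⟨_, ⟨c, hc, rfl⟩, x, hx, hy⟩
    · rintro ⟨_, ⟨c, hc, rfl⟩, x, hx, hy⟩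
      exact ⟨x, ⟨c, hc, hx⟩, hy⟩
  meet {c d m} hb hm h := by
    have hmc : m ≤ c := hm.1 (Set.mem_insert _ _)
    have hmd : m ≤ d := hm.1 (Set.mem_insert_of_mem _ rfl)
    refine Conf.isGLB_pair_of_forall (confMap_mono f hmc) (confMap_mono f hmd) ?_
    obtain ⟨b, hb⟩ := hb
    rcases h.covBy_or_eq with h | rfl
    · obtain ⟨e, hem, hc⟩ := Conf.eq_insert_of_covBy h
      rintro y ⟨⟨x, hx, hy⟩, ⟨x', hx', hy'⟩⟩
      -- Distinct preimages of `y` would conflict, although both lie in `b`. A common preimage equal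
      -- to the new event `e` would give `c ≤ d`, so `c` would lie below the meet `m`.
      by_cases hxx : x = x'
      · rw [hc] at hx
        rcases hx with rfl | hx
        · refine absurd (hm.2 (show c ∈ lowerBounds {c, d} from ?_)) (not_le_of_gt h.lt)
          rintro z (rfl | rfl)
          · exact le_rfl
          · show c.1 ⊆ z.1
            rw [hc]
            exact Set.insert_subset (hxx ▸ hx') hmd
        · exact ⟨x, hx, hy⟩
      · exact absurd (f.isHom.inj hy hy' hxx) (b.2.1 x (hb (Set.mem_insert _ _) hx) x'
          (hb (Set.mem_insert_of_mem _ rfl) hx'))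
    · exact Set.inter_subset_left

theorem domWellDefined : DomWellDefined.{u} :=
  ⟨fun E => Conf.isWeakPrimeDomain E.toEventStructure, fun f => isDomHom_confMap f⟩

/-! ### The event structure of a weak prime domain. -/

section Ev

variable {D : WDom.{u}}

theorem IrrClass.exists_mk_eq (c : IrrClass D) : ∃ i, IrrClass.mk i = c :=
  Quot.exists_rep c

theorem irrClasses_mono {X Y : Set D.carrier} (h : X ⊆ Y) : irrClasses X ⊆ irrClasses Y :=
  fun _ ⟨i, hi, hc⟩ => ⟨i, h hi, hc⟩

theorem irrClasses_finite {X : Set D.carrier} (h : X.Finite) :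
    (irrClasses X : Set (IrrClass D)).Finite := by
  have hX : {i : {i : D.carrier // IsIrreducible i} | i.1 ∈ X}.Finite :=
    h.preimage Subtype.val_injective.injOn
  refine (hX.image IrrClass.mk).subset ?_
  rintro _ ⟨i, hi, rfl⟩
  exact ⟨i, hi, rfl⟩

theorem irr_finite {d : D.carrier} (hd : IsCompactElement d) : (irr d).Finite :=
  (D.isWeakPrimeDomain.finitary d hd).subset fun _ h => h.2

theorem irr_mono {d d' : D.carrier} (h : d ≤ d') : irr d ⊆ irr d' :=
  fun _ hi => ⟨hi.1, hi.2.trans h⟩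

/-- The classes of the irreducibles below a compact element form a configuration. -/
theorem isConfiguration_irrClasses {d : D.carrier} (hd : IsCompactElement d) :
    (ev D).IsConfiguration (irrClasses (irr d)) := by
  refine ⟨fun e he e' he' h => h ⟨d, hd, he, he'⟩, ?_⟩
  rintro _ ⟨i, hi, rfl⟩
  -- Domains are finitary, so the number of elements below `i` is finite and decreases strictly when
  -- passing to an irreducible strictly below.
  induction h : (Set.Iic i.1).ncard using Nat.strong_induction_on generalizing i with
  | _ n ih =>
    subst h
    refine exists_secures_of_enab (E := ev D) (X := irrClasses (irr i.1 \ {i.1})) ⟨i, hi, rfl⟩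
      ⟨irrClasses_finite ((irr_finite i.2.1).subset Set.sdiff_subset), i, rfl, subset_rfl⟩ ?_
    rintro _ ⟨j, ⟨hj, hji⟩, rfl⟩
    refine ih _ (Set.ncard_lt_ncard ?_ (D.isWeakPrimeDomain.finitary _ i.2.1)) j
      ⟨hj.1, hj.2.trans hi.2⟩ rfl
    exact Set.Iic_ssubset_Iic.2 (lt_of_le_of_ne hj.2 hji)

theorem isLive_ev (D : WDom.{u}) : (ev D).IsLive := by
  constructor
  · rintro e e' h ⟨d, hd, he, he'⟩
    exact h ⟨_, isConfiguration_irrClasses hd, he, he'⟩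
  · intro e h
    obtain ⟨i, rfl⟩ := e.exists_mk_eq
    exact h ⟨i.1, i.2.1, ⟨i, ⟨i.2, le_rfl⟩, rfl⟩, ⟨i, ⟨i.2, le_rfl⟩, rfl⟩⟩

theorem mem_evMap_iff {D₁ D₂ : WDom.{u}} {f : D₁ ⟶ D₂} {e₁ : IrrClass D₁} {e₂ : IrrClass D₂}
    (h : ∀ e e', EvRel f e₁ e → EvRel f e₁ e' → e = e') : e₂ ∈ evMap f e₁ ↔ EvRel f e₁ e₂ := by
  constructor
  · rintro ⟨hex, rfl⟩
    exact hex.choose_spec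
  · exact fun he => ⟨⟨e₂, he⟩, h _ _ (Exists.choose_spec (⟨e₂, he⟩ : ∃ e, EvRel f e₁ e)) he⟩

end Ev

/-! ### Irreducible configurations and their labels. -/

/-- The weak prime domain of configurations. -/
abbrev confDom (E : ES.{u}) : WDom.{u} := ⟨Conf E.toEventStructure, Conf.isWeakPrimeDomain _⟩

/-- The morphism of domains of configurations induced by a morphism of event structures. -/
abbrev confHom {E₁ E₂ : ES.{u}} (f : E₁ ⟶ E₂) : confDom E₁ ⟶ confDom E₂ :=
  WDom.Hom.mk (D₁ := confDom E₁) (D₂ := confDom E₂) (confMap f) (isDomHom_confMap f)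

/-- The irreducible configurations. -/
abbrev IrrConf (E : ES.{u}) : Type u := {i : Conf E.toEventStructure // IsIrreducible i}

namespace IrrConf

variable {E : ES.{u}}

/-- The event of which an irreducible configuration is a history. -/
noncomputable def label (i : IrrConf E) : E.Event := (Conf.isIrreducible_iff.1 i.2).choose

theorem isHistory (i : IrrConf E) : E.IsHistory i.1.1 i.label :=
  (Conf.isIrreducible_iff.1 i.2).choose_spec

theorem label_eq {i : IrrConf E} {e : E.Event} (h : E.IsHistory i.1.1 e) : i.label = e :=
  i.isHistory.event_unique h

theorem label_mem (i : IrrConf E) : i.label ∈ i.1.1 := i.isHistory.mem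

theorem eq_of_le {i : IrrConf E} {c : Conf E.toEventStructure} (h : c ≤ i.1) (hc : i.label ∈ c.1) :
    c = i.1 :=
  Subtype.ext (i.isHistory.eq_of_subset c.2 hc h)

/-- The class of an irreducible configuration. -/
def toClass (i : IrrConf E) : IrrClass (confDom E) := IrrClass.mk (D := confDom E) i

theorem interchangeable_iff {i j : IrrConf E} :
    Interchangeable i.1 j.1 ↔ i.label = j.label ∧ BddAbove {i.1, j.1} :=
  Conf.interchangeable_iff i.isHistory j.isHistory

theorem toClass_eq {i j : IrrConf E} {c : Conf E.toEventStructure} (hi : i.1 ≤ c) (hj : j.1 ≤ c)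
    (h : i.label = j.label) : i.toClass = j.toClass := by
  refine Quot.sound (interchangeable_iff.2 ⟨h, c, ?_⟩)
  rintro x (rfl | rfl)
  exacts [hi, hj]

theorem exists_le_label_eq (c : Conf E.toEventStructure) {e : E.Event} (he : e ∈ c.1) :
    ∃ i : IrrConf E, i.1 ≤ c ∧ i.label = e := by
  obtain ⟨i, hi, h⟩ := c.exists_isHistory_le he
  exact ⟨⟨i, Conf.isIrreducible_iff.2 ⟨e, h⟩⟩, hi, label_eq h⟩

/-- The immediate predecessor of an irreducible configuration. -/
def pred (i : IrrConf E) : Conf E.toEventStructure :=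
  ⟨i.1.1 \ {i.label}, i.isHistory.isConfiguration_diff⟩

theorem pred_le (i : IrrConf E) : i.pred ≤ i.1 := fun _ h => h.1

theorem pred_covBy (i : IrrConf E) : i.pred ⋖ i.1 := by
  refine ⟨lt_of_le_not_ge i.pred_le fun h => (h i.label_mem).2 rfl, fun c hc hci => ?_⟩
  obtain ⟨e, hec, he⟩ := Set.not_subset.1 (not_le_of_gt hc)
  have hee : e = i.label := not_not.1 fun hne => he ⟨hci.le hec, hne⟩
  exact hci.ne (eq_of_le hci.le (hee ▸ hec))

/-- A proper subconfiguration of a history cannot contain its label, so `i.pred` is the largest one.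
-/
theorem eq_pred_of_covBy {i : IrrConf E} {p : Conf E.toEventStructure} (h : p ⋖ i.1) :
    p = i.pred := by
  have hle : p ≤ i.pred := fun x hx => ⟨h.le hx, fun hxi : x = i.label =>
    h.ne (eq_of_le h.le (hxi ▸ hx))⟩
  exact eq_of_le_of_not_lt hle fun hlt => h.2 hlt i.pred_covBy.lt

theorem irr_diff_self (i : IrrConf E) : irr i.1 \ {i.1} = irr i.pred := by
  ext j
  constructor
  · rintro ⟨⟨hj, hji⟩, hne⟩
    exact ⟨hj, fun x hx => ⟨hji hx, fun hxi : x = i.label => hne (eq_of_le hji (hxi ▸ hx))⟩⟩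
  · rintro ⟨hj, hji⟩
    refine ⟨⟨hj, hji.trans i.pred_le⟩, ?_⟩
    rintro rfl
    exact (hji i.label_mem).2 rfl

theorem isCompactElement_pred (i : IrrConf E) : IsCompactElement i.pred :=
  Conf.isCompactElement_of_finite (i.isHistory.finite.subset Set.sdiff_subset)

end IrrConf

/-! ### Classes of histories and the labelling morphism. -/

/-- The classes of the irreducible configurations contained in a configuration. -/
def confClasses {E : ES.{u}} (c : Conf E.toEventStructure) : Set (IrrClass (confDom E)) :=
  irrClasses (D := confDom E) (irr c)

section

variable {E : ES.{u}}

theorem exists_toClass_eq (c : IrrClass (confDom E)) : ∃ i : IrrConf E, i.toClass = c :=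
  c.exists_mk_eq

theorem toClass_mem_confClasses {i : IrrConf E} {c : Conf E.toEventStructure} (h : i.1 ≤ c) :
    i.toClass ∈ confClasses c :=
  ⟨i, ⟨i.2, h⟩, rfl⟩

theorem exists_of_mem_confClasses {c : Conf E.toEventStructure} {x : IrrClass (confDom E)}
    (h : x ∈ confClasses c) : ∃ i : IrrConf E, i.1 ≤ c ∧ i.toClass = x := by
  obtain ⟨i, hi, h⟩ := h
  exact ⟨i, hi.2, h⟩

theorem confClasses_mono {c d : Conf E.toEventStructure} (h : c ≤ d) :
    confClasses c ⊆ confClasses d :=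
  irrClasses_mono (D := confDom E) (irr_mono (D := confDom E) h)

theorem not_confl_iff {x y : IrrClass (confDom E)} :
    ¬ (ev (confDom E)).Confl x y ↔ ∃ d : Conf E.toEventStructure, IsCompactElement d ∧
      x ∈ confClasses d ∧ y ∈ confClasses d :=
  not_not

theorem enab_iff {X : Set (IrrClass (confDom E))} {x : IrrClass (confDom E)} :
    (ev (confDom E)).Enab X x ↔
      X.Finite ∧ ∃ i : IrrConf E, i.toClass = x ∧ confClasses i.pred ⊆ X := by
  refine and_congr_right fun _ => exists_congr fun i => and_congr_right fun _ => ?_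
  rw [confClasses, ← IrrConf.irr_diff_self]

theorem confClasses_isConfiguration {c : Conf E.toEventStructure} (hc : IsCompactElement c) :
    (ev (confDom E)).IsConfiguration (confClasses c) :=
  isConfiguration_irrClasses (D := confDom E) hc

theorem confClasses_finite {c : Conf E.toEventStructure} (hc : IsCompactElement c) :
    (confClasses c).Finite :=
  irrClasses_finite (D := confDom E) (irr_finite (D := confDom E) hc)

/-- The event of which the members of a class of irreducible configurations are histories. -/
noncomputable def classLabel : IrrClass (confDom E) → E.Event :=
  Quot.lift (fun i : IrrConf E => i.label) fun _ _ h => (IrrConf.interchangeable_iff.1 h).1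

theorem image_classLabel_confClasses (c : Conf E.toEventStructure) :
    classLabel '' confClasses c = c.1 := by
  ext e
  constructor
  · rintro ⟨_, hx, rfl⟩
    obtain ⟨i, hi, rfl⟩ := exists_of_mem_confClasses hx
    exact hi i.label_mem
  · intro he
    obtain ⟨i, hi, rfl⟩ := IrrConf.exists_le_label_eq c he
    exact ⟨_, toClass_mem_confClasses hi, rfl⟩

/-- Classes with the same label are equal or in conflict. -/
theorem eq_of_classLabel_eq {x y : IrrClass (confDom E)} (h : ¬ (ev (confDom E)).Confl x y)
    (hxy : classLabel x = classLabel y) : x = y := by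
  obtain ⟨d, -, hx, hy⟩ := not_confl_iff.1 h
  obtain ⟨i, hi, rfl⟩ := exists_of_mem_confClasses hx
  obtain ⟨j, hj, rfl⟩ := exists_of_mem_confClasses hy
  exact IrrConf.toClass_eq hi hj hxy

theorem image_lift {α β : Type*} (f : α → β) (X : Set α) :
    (PFun.lift f).image X = f '' X := by
  ext y
  simp [PFun.mem_image, eq_comm]

variable (E) in
-- The morphism underlying the counit. Classes that are not in conflict have members inside one
-- configuration, where labels cannot conflict and equal labels give equal classes. Enabling is
-- preserved because the labels of the classes below `i.pred` are exactly its events.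
theorem isHom_classLabel :
    IsHom (ev (confDom E)) E.toEventStructure (PFun.lift classLabel) where
  confl {x x' y y'} hy hy' h := by
    obtain rfl := Part.mem_some_iff.1 hy
    obtain rfl := Part.mem_some_iff.1 hy'
    by_contra hc
    obtain ⟨d, -, hx, hx'⟩ := not_confl_iff.1 hc
    obtain ⟨i, hi, rfl⟩ := exists_of_mem_confClasses hx
    obtain ⟨j, hj, rfl⟩ := exists_of_mem_confClasses hx'
    exact d.2.1 _ (hi i.label_mem) _ (hj j.label_mem) h
  inj {x x' y} hy hy' hne := by
    have h := (Part.mem_some_iff.1 hy).symm.trans (Part.mem_some_iff.1 hy')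
    by_contra hc
    exact hne (eq_of_classLabel_eq hc h)
  enab {C x y} _ h hy := by
    obtain rfl := Part.mem_some_iff.1 hy
    obtain ⟨hC, i, rfl, hi⟩ := enab_iff.1 h
    refine E.enab_mono i.isHistory.enab_diff ?_ (finite_image _ hC)
    exact ((image_classLabel_confClasses i.pred).symm.subset.trans (Set.image_mono hi)).trans
      (image_lift classLabel C).symm.subset

/-! ### Connectedness -/

/-- If a smaller set enables the same class through `j`, passing to labels gives `j ≤ i`; both are
histories of the same event, so `j = i`. -/
theorem minEnab_iff {x : IrrClass (confDom E)} {C : Set (IrrClass (confDom E))} :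
    (ev (confDom E)).MinEnab C x ↔ ∃ i : IrrConf E, i.toClass = x ∧ C = confClasses i.pred := by
  have hen : ∀ i : IrrConf E, (ev (confDom E)).Enab (confClasses i.pred) i.toClass := fun i =>
    enab_iff.2 ⟨confClasses_finite i.isCompactElement_pred, i, rfl, subset_rfl⟩
  constructor
  · rintro ⟨-, h, hmin⟩
    obtain ⟨-, i, rfl, hi⟩ := enab_iff.1 h
    exact ⟨i, rfl, (hmin _ (confClasses_isConfiguration i.isCompactElement_pred) hi (hen i)).symm⟩
  · rintro ⟨i, rfl, rfl⟩
    refine ⟨confClasses_isConfiguration i.isCompactElement_pred, hen i, fun C' _ hsub h => ?_⟩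
    obtain ⟨-, j, hji, hj⟩ := enab_iff.1 h
    have hlab : j.label = i.label := congrArg classLabel hji
    have hle : j.1 ≤ i.1 := fun x hx => by
      by_cases hxj : x = j.label
      · rw [hxj, hlab]
        exact i.label_mem
      · have : x ∈ j.pred.1 := ⟨hx, hxj⟩
        rw [← image_classLabel_confClasses] at this
        have := Set.image_mono (f := classLabel) (hj.trans hsub) this
        rw [image_classLabel_confClasses] at this
        exact i.pred_le this
    have : j = i := Subtype.ext (IrrConf.eq_of_le hle (hlab ▸ j.label_mem))
    exact hsub.antisymm (this ▸ hj)

/-- The union of the two histories is a finite configuration, and its classes include both enablings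
and the enabled event. -/
theorem adjacent_of_interchangeable {i j : IrrConf E} (h : Interchangeable i.1 j.1) :
    (ev (confDom E)).Adjacent i.toClass (confClasses i.pred) (confClasses j.pred) := by
  have hcl : i.toClass = j.toClass := Quot.sound h
  refine ⟨minEnab_iff.2 ⟨i, rfl, rfl⟩, minEnab_iff.2 ⟨j, hcl.symm, rfl⟩, ?_⟩
  obtain ⟨-, b, hb⟩ := IrrConf.interchangeable_iff.1 h
  have hib : i.1 ≤ b := hb (Set.mem_insert _ _)
  have hjb : j.1 ≤ b := hb (Set.mem_insert_of_mem _ rfl)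
  let u : Conf E.toEventStructure :=
    ⟨i.1.1 ∪ j.1.1, i.1.2.union j.1.2 (b.2.1.mono (Set.union_subset hib hjb))⟩
  have hiu : i.1 ≤ u := Set.subset_union_left
  have hju : j.1 ≤ u := Set.subset_union_right
  refine (confClasses_isConfiguration (c := u) (Conf.isCompactElement_of_finite
    (i.isHistory.finite.union j.isHistory.finite))).1.mono ?_
  refine Set.union_subset (Set.union_subset (confClasses_mono (i.pred_le.trans hiu))
    (confClasses_mono (j.pred_le.trans hju))) ?_
  exact Set.singleton_subset_iff.2 (toClass_mem_confClasses hiu)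

theorem _root_.ConnES.EventStructure.Adjacent.symm {E : EventStructure.{u}} {e : E.Event}
    {C C' : Set E.Event} (h : E.Adjacent e C C') : E.Adjacent e C' C :=
  ⟨h.2.1, h.1, by rw [Set.union_comm C' C]; exact h.2.2⟩

variable (E) in
theorem isConnected_ev : (ev (confDom E)).IsConnected := by
  intro x C C' hC hC'
  obtain ⟨i, hi, rfl⟩ := minEnab_iff.1 hC
  obtain ⟨j, hj, rfl⟩ := minEnab_iff.1 hC'
  have key : ∀ i j : IrrConf E,
      Relation.EqvGen (fun i j : IrrConf E => Interchangeable i.1 j.1) i j → i.toClass = x → Relation.TransGen ((ev (confDom E)).Adjacent x)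
        (confClasses i.pred) (confClasses j.pred) := by
    intro i j h
    induction h with
    | rel i j h =>
      rintro rfl
      exact .single (adjacent_of_interchangeable h)
    | refl i =>
      rintro rfl
      -- The transitive closure is not reflexive, so a step from the enabling to itself is supplied.
      refine .single (adjacent_of_interchangeable
        (IrrConf.interchangeable_iff.2 ⟨rfl, i.1, ?_⟩))
      rintro y (rfl | rfl) <;> exact le_rfl
    | symm i j h ih =>
      intro hj
      have hij : i.toClass = j.toClass := Quot.eqvGen_sound h
      have : Std.Symm ((ev (confDom E)).Adjacent x) := ⟨fun _ _ h => h.symm⟩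
      exact Relation.TransGen.stdSymm.symm _ _ (ih (hij.trans hj))
    | trans i j k h _ ih ih' =>
      intro hi
      have hij : i.toClass = j.toClass := Quot.eqvGen_sound h
      exact (ih hi).trans (ih' (hij.symm.trans hi))
  exact key i j (Quot.eqvGen_exact (hi.trans hj.symm)) hi

end

/-! ### Morphisms -/

section

variable {E₁ E₂ E₃ : ES.{u}} (f : E₁ ⟶ E₂) (g : E₂ ⟶ E₃)

/-- Among the irreducibles below `f i` but not below `f p`, with `p` the predecessor of `i`, the
minimal ones are the histories of the image of the label of `i`. -/
theorem minimal_irr_diff_iff {i : IrrConf E₁} {j : IrrConf E₂} :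
    Minimal (· ∈ irr (confMap f i.1) \ irr (confMap f i.pred)) j.1 ↔
      j.1 ≤ confMap f i.1 ∧ j.label ∈ f.toPFun i.label := by
  -- An irreducible that is new at `f i` must contain an image of the label of `i`: the images of
  -- all other events of `i` are already in the image of `i.pred`.
  have hnew : ∀ k : Conf E₂.toEventStructure, k ∈ irr (confMap f i.1) \ irr (confMap f i.pred) →
      ∃ y ∈ k.1, y ∈ f.toPFun i.label ∧ y ∉ (confMap f i.pred).1 := by
    rintro k ⟨⟨hk, hki⟩, hkp⟩
    obtain ⟨y, hyk, hy⟩ := Set.not_subset.1 (fun h => hkp ⟨hk, h⟩ : ¬ k ≤ confMap f i.pred)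
    obtain ⟨x, hx, hxy⟩ := hki hyk
    refine ⟨y, hyk, ?_, hy⟩
    by_cases hxi : x = i.label
    · exact hxi ▸ hxy
    · exact absurd ⟨x, ⟨hx, hxi⟩, hxy⟩ hy
  constructor
  · intro h
    refine ⟨h.prop.1.2, ?_⟩
    obtain ⟨y, hyj, hyi, hy⟩ := hnew _ h.prop
    obtain ⟨k, hkj, rfl⟩ := IrrConf.exists_le_label_eq j.1 hyj
    have hjk : j.1 ≤ k.1 := h.2 (y := k.1)
      ⟨⟨k.2, hkj.trans h.prop.1.2⟩, fun hk => hy (hk.2 k.label_mem)⟩ hkj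
    obtain rfl : k = j := Subtype.ext (le_antisymm hkj hjk)
    exact hyi
  · rintro ⟨hji, hlab⟩
    refine ⟨⟨⟨j.2, hji⟩, fun hj => ?_⟩, fun k hk hkj => ?_⟩
    · obtain ⟨x, hx, hxj⟩ := hj.2 j.label_mem
      -- A second preimage of the label of `j` in `i.pred` would conflict with the label of `i`
      -- inside `i`.
      exact i.1.2.1 _ hx.1 _ i.label_mem (f.isHom.inj hxj hlab hx.2)
    · obtain ⟨y, hyk, hyi, -⟩ := hnew k hk
      exact (IrrConf.eq_of_le hkj (Part.mem_unique hyi hlab ▸ hyk)).ge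

theorem evRel_iff {x : IrrClass (confDom E₁)} {y : IrrClass (confDom E₂)} :
    EvRel (confHom f) x y ↔ ∃ (i : IrrConf E₁) (j : IrrConf E₂), i.toClass = x ∧
      j.1 ≤ confMap f i.1 ∧ j.label ∈ f.toPFun i.label ∧ j.toClass = y := by
  constructor
  · rintro ⟨i, p, j, hi, hp, hj, hy⟩
    obtain rfl : p = IrrConf.pred i := IrrConf.eq_pred_of_covBy hp
    obtain ⟨h₁, h₂⟩ := (minimal_irr_diff_iff (i := i) (j := j) f).1 hj
    exact ⟨i, j, hi, h₁, h₂, hy⟩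
  · rintro ⟨i, j, hi, h₁, h₂, hy⟩
    exact ⟨i, i.pred, j, hi, i.pred_covBy, (minimal_irr_diff_iff f).2 ⟨h₁, h₂⟩, hy⟩

theorem image_classes_eq_of_interchangeable {i i' : IrrConf E₁} (h : Interchangeable i.1 i'.1)
    {j : IrrConf E₂} (hj : j.1 ≤ confMap f i.1) (hlab : j.label ∈ f.toPFun i.label) :
    ∃ j' : IrrConf E₂, j'.1 ≤ confMap f i'.1 ∧ j'.label ∈ f.toPFun i'.label ∧
      j'.toClass = j.toClass := by
  obtain ⟨hii, b, hb⟩ := IrrConf.interchangeable_iff.1 h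
  rw [hii] at hlab
  obtain ⟨j', hj', hjj⟩ := IrrConf.exists_le_label_eq (confMap f i'.1) (e := j.label)
    ⟨_, i'.label_mem, hlab⟩
  refine ⟨j', hj', hjj ▸ hlab, IrrConf.toClass_eq (c := confMap f b) ?_ ?_ hjj⟩
  · exact hj'.trans (confMap_mono f (hb (Set.mem_insert_of_mem _ rfl)))
  · exact hj.trans (confMap_mono f (hb (Set.mem_insert _ _)))

/-- The set `S i` of image classes is invariant under interchangeability, so it descends to the
quotient and may be computed at any representative. -/
theorem evRel_toClass_iff {i : IrrConf E₁} {y : IrrClass (confDom E₂)} :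
    EvRel (confHom f) i.toClass y ↔ ∃ j : IrrConf E₂, j.1 ≤ confMap f i.1 ∧
      j.label ∈ f.toPFun i.label ∧ j.toClass = y := by
  let S : IrrConf E₁ → Set (IrrClass (confDom E₂)) := fun i =>
    {y | ∃ j : IrrConf E₂, j.1 ≤ confMap f i.1 ∧ j.label ∈ f.toPFun i.label ∧ j.toClass = y}
  have hsub : ∀ i i' : IrrConf E₁, Interchangeable i.1 i'.1 → S i ⊆ S i' := by
    rintro i i' h _ ⟨j, hj, hlab, rfl⟩
    exact image_classes_eq_of_interchangeable f h hj hlab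
  have hS : ∀ i i' : IrrConf E₁, Interchangeable i.1 i'.1 → S i = S i' := fun i i' h => by
    refine (hsub i i' h).antisymm (hsub i' i (IrrConf.interchangeable_iff.2 ?_))
    obtain ⟨hii, hb⟩ := IrrConf.interchangeable_iff.1 h
    exact ⟨hii.symm, Set.pair_comm i.1 i'.1 ▸ hb⟩
  rw [evRel_iff]
  constructor
  · rintro ⟨i', j, hi', h⟩
    have hSS : S i' = S i := congrArg (Quot.lift S hS) hi'
    exact (hSS ▸ (⟨j, h⟩ : y ∈ S i') : y ∈ S i)
  · rintro ⟨j, h⟩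
    exact ⟨i, j, rfl, h⟩

theorem mem_evMap_confHom_iff {x : IrrClass (confDom E₁)} {y : IrrClass (confDom E₂)} :
    y ∈ evMap (confHom f) x ↔ EvRel (confHom f) x y := by
  refine mem_evMap_iff fun y y' hy hy' => ?_
  obtain ⟨i, rfl⟩ := exists_toClass_eq x
  obtain ⟨j, hj, hlab, rfl⟩ := (evRel_toClass_iff f).1 hy
  obtain ⟨j', hj', hlab', rfl⟩ := (evRel_toClass_iff f).1 hy'
  exact IrrConf.toClass_eq hj hj' (Part.mem_unique hlab hlab')

theorem mem_evMap_toClass_iff {i : IrrConf E₁} {y : IrrClass (confDom E₂)} :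
    y ∈ evMap (confHom f) i.toClass ↔ ∃ j : IrrConf E₂, j.1 ≤ confMap f i.1 ∧
      j.label ∈ f.toPFun i.label ∧ j.toClass = y :=
  (mem_evMap_confHom_iff f).trans (evRel_toClass_iff f)

theorem classLabel_mem_of_mem_evMap {x : IrrClass (confDom E₁)} {y : IrrClass (confDom E₂)}
    (h : y ∈ evMap (confHom f) x) : classLabel y ∈ f.toPFun (classLabel x) := by
  obtain ⟨i, rfl⟩ := exists_toClass_eq x
  obtain ⟨j, -, hlab, rfl⟩ := (mem_evMap_toClass_iff f).1 h
  exact hlab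

theorem mem_confClasses_of_mem_evMap {c : Conf E₁.toEventStructure} {x : IrrClass (confDom E₁)}
    {y : IrrClass (confDom E₂)} (hx : x ∈ confClasses c) (h : y ∈ evMap (confHom f) x) :
    y ∈ confClasses (confMap f c) := by
  obtain ⟨i, hi, rfl⟩ := exists_of_mem_confClasses hx
  obtain ⟨j, hj, -, rfl⟩ := (mem_evMap_toClass_iff f).1 h
  exact toClass_mem_confClasses (hj.trans (confMap_mono f hi))

theorem isCompactElement_confMap {c : Conf E₁.toEventStructure} (hc : IsCompactElement c) :
    IsCompactElement (confMap f c) :=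
  Conf.isCompactElement_of_finite (finite_image f.toPFun (Conf.finite_of_isCompactElement hc))

theorem isHom_evMap : IsHom (ev (confDom E₁)) (ev (confDom E₂)) (evMap (confHom f)) where
  confl {x x' y y'} hy hy' h := by
    by_contra hc
    obtain ⟨d, hd, hx, hx'⟩ := not_confl_iff.1 hc
    exact h ⟨_, isCompactElement_confMap f hd, mem_confClasses_of_mem_evMap f hx hy,
      mem_confClasses_of_mem_evMap f hx' hy'⟩
  inj {x x' y} hy hy' hne := by
    by_contra hc
    have h := classLabel_mem_of_mem_evMap f hy
    have h' := classLabel_mem_of_mem_evMap f hy'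
    by_cases hl : classLabel x = classLabel x'
    · exact hne (eq_of_classLabel_eq hc hl)
    · exact hc ((isHom_classLabel E₁).confl (Part.mem_some _) (Part.mem_some _)
        (f.isHom.inj h h' hl))
  enab {C x y} _ h hy := by
    obtain ⟨hC, i, rfl, hi⟩ := enab_iff.1 h
    obtain ⟨j, hj, hlab, rfl⟩ := (mem_evMap_toClass_iff f).1 hy
    refine enab_iff.2 ⟨finite_image _ hC, j, rfl, fun z hz => ?_⟩
    obtain ⟨k, hk, rfl⟩ := exists_of_mem_confClasses hz
    -- Pull the label of `k` back to an event `x` of `i`. It differs from the label of `i`, so it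
    -- has a history `l` below `i.pred`, whose class lies in `C`. A history `k'` of the label of `k`
    -- in the image of `l` has the same class as `k`, since both lie below the image of `i`.
    obtain ⟨x, hx, hxk⟩ := hj (j.pred_le (hk k.label_mem))
    have hxi : x ≠ i.label := by
      rintro rfl
      exact (hk k.label_mem).2 (Part.mem_unique hxk hlab)
    obtain ⟨l, hl, rfl⟩ := IrrConf.exists_le_label_eq i.pred (e := x) ⟨hx, hxi⟩
    obtain ⟨k', hk', hkk⟩ := IrrConf.exists_le_label_eq (confMap f l.1) (e := k.label)
      ⟨_, l.label_mem, hxk⟩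
    refine ⟨l.toClass, hi (toClass_mem_confClasses hl), (mem_evMap_toClass_iff f).2
      ⟨k', hk', hkk ▸ hxk, IrrConf.toClass_eq (c := confMap f i.1) ?_ ?_ hkk⟩⟩
    · exact hk'.trans (confMap_mono f (hl.trans i.pred_le))
    · exact (hk.trans j.pred_le).trans hj

theorem evMap_confHom_id (E : ES.{u}) : evMap (confHom (𝟙 E)) = PFun.id (IrrClass (confDom E)) := by
  refine PFun.ext fun x y => ?_
  obtain ⟨i, rfl⟩ := exists_toClass_eq x
  have hid : confMap (𝟙 E) i.1 = i.1 := congrFun (congrArg WDom.Hom.toFun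
    ((domFunctor domWellDefined).map_id E)) i.1
  refine (mem_evMap_toClass_iff (𝟙 E)).trans (Iff.trans ?_ Part.mem_some_iff.symm)
  rw [hid]
  constructor
  · rintro ⟨j, hj, hlab, rfl⟩
    exact IrrConf.toClass_eq hj le_rfl (Part.mem_some_iff.1 hlab)
  · rintro rfl
    exact ⟨i, le_rfl, Part.mem_some _, rfl⟩

theorem evMap_confHom_comp :
    evMap (confHom (f ≫ g)) = (evMap (confHom g)).comp (evMap (confHom f)) := by
  refine PFun.ext fun x z => ?_
  obtain ⟨i, rfl⟩ := exists_toClass_eq x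
  have hcomp : confMap (f ≫ g) i.1 = confMap g (confMap f i.1) :=
    Subtype.ext (image_comp g.toPFun f.toPFun i.1.1)
  refine (mem_evMap_toClass_iff (f ≫ g)).trans (Iff.trans ?_ Part.mem_bind_iff.symm)
  rw [hcomp]
  constructor
  · rintro ⟨k, hk, hlab, rfl⟩
    obtain ⟨y, hy, hyk⟩ := Part.mem_bind_iff.1 hlab
    obtain ⟨j, hj, rfl⟩ := IrrConf.exists_le_label_eq (confMap f i.1) (e := y)
      ⟨_, i.label_mem, hy⟩
    obtain ⟨k', hk', hkk⟩ := IrrConf.exists_le_label_eq (confMap g j.1) (e := k.label)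
      ⟨_, j.label_mem, hyk⟩
    exact ⟨j.toClass, (mem_evMap_toClass_iff f).2 ⟨j, hj, hy, rfl⟩, (mem_evMap_toClass_iff g).2
      ⟨k', hk', hkk ▸ hyk, IrrConf.toClass_eq (hk'.trans (confMap_mono g hj)) hk hkk⟩⟩
  · rintro ⟨_, hy, hz⟩
    obtain ⟨j, hj, hlab, rfl⟩ := (mem_evMap_toClass_iff f).1 hy
    obtain ⟨k, hk, hlab', rfl⟩ := (mem_evMap_toClass_iff g).1 hz
    exact ⟨k, hk.trans (confMap_mono g hj), Part.mem_bind_iff.2 ⟨_, hlab, hlab'⟩, rfl⟩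

end

theorem connWellDefined : ConnWellDefined domWellDefined.{u} where
  live E := isLive_ev (confDom E)
  connected E := isConnected_ev E
  graph f _ _ := mem_evMap_confHom_iff f
  isHom f := isHom_evMap f
  map_id E := evMap_confHom_id E
  map_comp f g := evMap_confHom_comp f g

/-! ### The coreflection -/

/-- The functor from event structures to connected event structures, with values in `ES`. -/
noncomputable abbrev evConf : ES.{u} ⥤ ES.{u} :=
  connFunctor domWellDefined connWellDefined ⋙ connected.ι

/-- The counit of the coreflection: the class of a history of `e` is mapped to `e`. -/
noncomputable def counitHom (E : ES.{u}) : evConf.obj E ⟶ E :=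
  ES.Hom.mk (E₁ := evConf.obj E) (PFun.lift (classLabel (E := E))) (isHom_classLabel E)

theorem counitHom_naturality {E₁ E₂ : ES.{u}} (f : E₁ ⟶ E₂) :
    evConf.map f ≫ counitHom E₂ = counitHom E₁ ≫ f := by
  refine ES.Hom.ext (PFun.ext fun (x : IrrClass (confDom E₁)) y => ?_)
  refine Part.mem_bind_iff.trans (Iff.trans ?_ Part.mem_bind_iff.symm)
  constructor
  · rintro ⟨z, hz, hy⟩
    rw [Part.mem_some_iff.1 hy]
    exact ⟨_, Part.mem_some _, classLabel_mem_of_mem_evMap f hz⟩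
  · rintro ⟨_, hx, hy⟩
    obtain rfl := Part.mem_some_iff.1 hx
    obtain ⟨i, rfl⟩ := exists_toClass_eq x
    obtain ⟨j, hj, rfl⟩ := IrrConf.exists_le_label_eq (confMap f i.1) (e := y)
      ⟨_, i.label_mem, hy⟩
    exact ⟨j.toClass, (mem_evMap_toClass_iff f).2 ⟨j, hj, hy, rfl⟩, Part.mem_some _⟩

/-- In a connected event structure all the histories of an event have the same class. -/
theorem toClass_eq_of_label_eq {E : ES.{u}} (hE : E.toEventStructure.IsConnected)
    {i j : IrrConf E} (h : i.label = j.label) : i.toClass = j.toClass := by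
  have key : ∀ C, Relation.TransGen (E.Adjacent i.label) i.pred.1 C →
      ∀ k : IrrConf E, k.label = i.label → k.pred.1 = C → i.toClass = k.toClass := by
    have hun : ∀ k : IrrConf E, k.1.1 = insert k.label k.pred.1 := fun k => by
      simp [IrrConf.pred, Set.insert_eq_of_mem k.label_mem]
    have hadj : ∀ k l : IrrConf E, k.label = i.label → l.label = i.label →
        E.Adjacent i.label k.pred.1 l.pred.1 → k.toClass = l.toClass := by
      intro k l hk hl ⟨_, _, hcons⟩
      have hcons' : E.Consistent (k.1.1 ∪ l.1.1) := by
        refine hcons.mono ?_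
        rw [hun k, hun l, hk, hl]
        rintro x ((hx | hx) | (hx | hx))
        exacts [Or.inr hx, Or.inl (Or.inl hx), Or.inr hx, Or.inl (Or.inr hx)]
      exact Quot.sound (IrrConf.interchangeable_iff.2 ⟨hk.trans hl.symm, Conf.bddAbove_pair hcons'⟩)
    intro C hC
    induction hC with
    | single hadj' =>
      rintro k hk rfl
      exact hadj i k rfl hk hadj'
    | @tail B C _ hadj' ih =>
      rintro k hk rfl
      -- Adjacency makes `B` consistent with the event, so `B` is the predecessor of a history `l`,
      -- through which the chain of classes passes.
      have hB : E.IsHistory (insert i.label B) i.label := hadj'.1.isHistory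
        (hadj'.2.2.mono (by
          rintro x (rfl | hx)
          exacts [Or.inr rfl, Or.inl (Or.inl hx)]))
      let l : IrrConf E := ⟨⟨_, hB.isConfiguration⟩, Conf.isIrreducible_iff.2 ⟨_, hB⟩⟩
      have hl : l.label = i.label := IrrConf.label_eq hB
      have hlB : l.pred.1 = B := by
        change insert i.label B \ {l.label} = B
        rw [hl, Set.insert_sdiff_self_of_notMem hadj'.1.notMem]
      exact (ih l hl hlB).trans (hadj l k hl hk (hlB ▸ hadj'))
  refine key _ (hE i.label _ j.pred.1 i.isHistory.minEnab ?_) j h.symm rfl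
  rw [h]
  exact j.isHistory.minEnab

/-- Liveness: an event in no configuration would conflict with itself. -/
theorem exists_label_eq {E : ES.{u}} (e : E.Event) : ∃ i : IrrConf E, i.label = e := by
  by_contra h
  refine E.live.2 e (E.live.1 e e ?_)
  rintro ⟨C, hC, he, -⟩
  obtain ⟨i, -, hi⟩ := IrrConf.exists_le_label_eq ⟨C, hC⟩ he
  exact h ⟨i, hi⟩

/-- The class of the histories of an event. -/
noncomputable def eventClass {E : ES.{u}} (e : E.Event) : IrrClass (confDom E) :=
  (exists_label_eq e).choose.toClass

theorem classLabel_eventClass {E : ES.{u}} (e : E.Event) : classLabel (eventClass e) = e :=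
  (exists_label_eq e).choose_spec

theorem eventClass_label {E : ES.{u}} (hE : E.toEventStructure.IsConnected) (i : IrrConf E) :
    eventClass i.label = i.toClass :=
  toClass_eq_of_label_eq hE (exists_label_eq i.label).choose_spec

theorem isHom_eventClass {E : ES.{u}} (hE : E.toEventStructure.IsConnected) :
    IsHom E.toEventStructure (ev (confDom E)) (PFun.lift eventClass) where
  confl {e e' y y'} hy hy' h := by
    obtain rfl := Part.mem_some_iff.1 hy
    obtain rfl := Part.mem_some_iff.1 hy'
    refine E.live.1 e e' ?_
    rintro ⟨C, hC, he, he'⟩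
    obtain ⟨i, hi, rfl⟩ := IrrConf.exists_le_label_eq ⟨C, hC⟩ he
    obtain ⟨j, hj, rfl⟩ := IrrConf.exists_le_label_eq ⟨C, hC⟩ he'
    rw [eventClass_label hE, eventClass_label hE] at h
    let u : Conf E.toEventStructure :=
      ⟨i.1.1 ∪ j.1.1, i.1.2.union j.1.2 (hC.1.mono (Set.union_subset hi hj))⟩
    exact h ⟨u, Conf.isCompactElement_of_finite (i.isHistory.finite.union j.isHistory.finite),
      toClass_mem_confClasses (c := u) Set.subset_union_left,
      toClass_mem_confClasses (c := u) Set.subset_union_right⟩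
  inj {e e' y} hy hy' hne := by
    have h := (Part.mem_some_iff.1 hy).symm.trans (Part.mem_some_iff.1 hy')
    have := congrArg classLabel h
    rw [classLabel_eventClass, classLabel_eventClass] at this
    exact absurd this hne
  enab {C e y} hC h hy := by
    obtain rfl := Part.mem_some_iff.1 hy
    obtain ⟨B, hBC, hB⟩ := hC.exists_minEnab h
    -- Connectedness applied to the pair `B`, `B` gives a nonempty chain, whose first step contains
    -- the consistency of `B` with `e`.
    have hcons : E.Consistent (insert e B) := by
      obtain ⟨_, hadj, -⟩ := Relation.TransGen.head'_iff.1 (hE e B B hB hB)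
      refine hadj.2.2.mono ?_
      rintro x (rfl | hx)
      exacts [Or.inr rfl, Or.inl (Or.inl hx)]
    have hI := hB.isHistory hcons
    let i : IrrConf E := ⟨⟨_, hI.isConfiguration⟩, Conf.isIrreducible_iff.2 ⟨_, hI⟩⟩
    have hi : i.label = e := IrrConf.label_eq hI
    refine enab_iff.2 ⟨finite_image _ (E.enab_finite h), i, by rw [← eventClass_label hE, hi], ?_⟩
    intro z hz
    obtain ⟨k, hk, rfl⟩ := exists_of_mem_confClasses hz
    have hki := hk k.label_mem
    have hkB : k.label ∈ B := hki.1.resolve_left fun hke => hki.2 (hke.trans hi.symm)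
    exact ⟨k.label, hBC hkB, Part.mem_some_iff.2 (eventClass_label hE k).symm⟩

/-- The unit of the coreflection, inverse to the counit at connected event structures. -/
noncomputable def unitHom (A : CES.{u}) :
    A ⟶ (connFunctor domWellDefined connWellDefined).obj A.obj :=
  ObjectProperty.homMk (ES.Hom.mk (E₂ := evConf.obj A.obj)
    (PFun.lift (eventClass (E := A.obj))) (isHom_eventClass A.property))

theorem unitHom_counitHom (A : CES.{u}) :
    (unitHom A).hom ≫ counitHom A.obj = 𝟙 A.obj := by
  refine ES.Hom.ext (PFun.ext fun e y => ?_)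
  refine Part.mem_bind_iff.trans (Iff.trans ?_ Part.mem_some_iff.symm)
  constructor
  · rintro ⟨_, hx, hy⟩
    obtain rfl := Part.mem_some_iff.1 hx
    exact (Part.mem_some_iff.1 hy).trans (classLabel_eventClass e)
  · rintro rfl
    exact ⟨_, Part.mem_some _, Part.mem_some_iff.2 (classLabel_eventClass y).symm⟩

theorem counitHom_unitHom (A : CES.{u}) :
    counitHom A.obj ≫ (unitHom A).hom = 𝟙 (evConf.obj A.obj) := by
  refine ES.Hom.ext (PFun.ext fun (x : IrrClass (confDom A.obj)) y => ?_)
  refine Part.mem_bind_iff.trans (Iff.trans ?_ Part.mem_some_iff.symm)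
  obtain ⟨i, rfl⟩ := exists_toClass_eq x
  constructor
  · rintro ⟨_, hx, hy⟩
    obtain rfl := Part.mem_some_iff.1 hx
    exact (Part.mem_some_iff.1 hy).trans (eventClass_label A.property i)
  · rintro rfl
    exact ⟨_, Part.mem_some _, Part.mem_some_iff.2 (eventClass_label A.property i).symm⟩

/-- On event structures of classes, the image of the counit is the counit. -/
theorem evConf_map_counitHom (E : ES.{u}) :
    evConf.map (counitHom E) = counitHom (evConf.obj E) := by
  refine ES.Hom.ext (PFun.ext fun (x : IrrClass (confDom (evConf.obj E))) y => ?_)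
  obtain ⟨I, rfl⟩ := exists_toClass_eq x
  have key : ∀ j : IrrConf E, j.1 ≤ confMap (counitHom E) I.1 →
      j.label ∈ (counitHom E).toPFun I.label → j.toClass = I.label := by
    intro j hj hlab
    -- The history `I` enables its own label through a member `i` of that class. All events of `i`
    -- then occur among the labels of `I`, so `i` and `j` are histories of the same event below the
    -- image of `I`, hence in the same class.
    obtain ⟨-, i, hi, hsub⟩ := enab_iff.1 I.isHistory.enab_diff
    have hji : j.label = i.label := (Part.mem_some_iff.1 hlab).trans (congrArg classLabel hi.symm)
    refine Eq.trans (IrrConf.toClass_eq hj (fun e he => ?_) hji) hi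
    by_cases hei : e = i.label
    · exact ⟨I.label, I.label_mem, by rw [hei, ← hji]; exact hlab⟩
    · have he' : e ∈ i.pred.1 := ⟨he, hei⟩
      rw [← image_classLabel_confClasses] at he'
      obtain ⟨z, hz, rfl⟩ := he'
      exact ⟨z, (hsub hz).1, Part.mem_some _⟩
  refine (mem_evMap_toClass_iff (counitHom E)).trans (Iff.trans ?_ Part.mem_some_iff.symm)
  constructor
  · rintro ⟨j, hj, hlab, rfl⟩
    exact key j hj hlab
  · rintro rfl
    obtain ⟨j, hj, hlab⟩ := IrrConf.exists_le_label_eq (confMap (counitHom E) I.1)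
      (e := classLabel I.label) ⟨_, I.label_mem, Part.mem_some _⟩
    have hlab' : j.label ∈ (counitHom E).toPFun I.label := by
      rw [hlab]
      exact Part.mem_some _
    exact ⟨j, hj, hlab', key j hj hlab'⟩

/-- The functor to connected event structures is right adjoint to the inclusion. -/
noncomputable def coreflection :
    connected.{u}.ι ⊣ connFunctor domWellDefined connWellDefined :=
  Adjunction.mkOfUnitCounit
    { unit :=
        { app := unitHom
          naturality := fun A B f => by
            refine ObjectProperty.hom_ext _ ?_
            change f.hom ≫ (unitHom B).hom = (unitHom A).hom ≫ evConf.map f.hom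
            -- Inserting `counitHom ≫ unitHom` as an identity reduces naturality of the unit to that
            -- of the counit.
            rw [← Category.comp_id (evConf.map f.hom), ← counitHom_unitHom B,
              ← Category.assoc (evConf.map f.hom), counitHom_naturality, Category.assoc,
              ← Category.assoc (unitHom A).hom, unitHom_counitHom, Category.id_comp] }
      counit :=
        { app := counitHom
          naturality := fun _ _ f => counitHom_naturality f }
      left_triangle := by
        ext A : 2
        exact (congrArg ((unitHom A).hom ≫ ·) (Category.id_comp (counitHom A.obj))).trans
          (unitHom_counitHom A)
      right_triangle := by
        ext E : 2
        refine ObjectProperty.hom_ext _ ?_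
        change (unitHom _).hom ≫ 𝟙 _ ≫ evConf.map (counitHom E) = 𝟙 (evConf.obj E)
        -- The image of the counit is the counit at a connected event structure, where the unit is
        -- its inverse.
        rw [Category.id_comp, evConf_map_counitHom]
        exact unitHom_counitHom _ }

end ConnES

/-- Taking configurations is a well-defined functor `ES ⥤ wDom`; composed with `ev` it is a
well-defined functor `ES ⥤ cES`, and this functor is right adjoint to the (full) inclusion
`cES ⥤ ES`. -/
theorem mainTheorem4 :
    ∃ (h : ConnES.DomWellDefined.{u}) (h' : ConnES.ConnWellDefined h),
      Nonempty (ConnES.connected.{u}.ι ⊣ ConnES.connFunctor h h') :=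
  ⟨ConnES.domWellDefined, ConnES.connWellDefined, ⟨ConnES.coreflection⟩⟩
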